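/- All rings are commutative, noetherian and local. For such a ring $R$, let $D(R)$ be the derived category of $R$-modules. A complex $X\in D(R)$ is *homologically bounded* if $H_i(X)=0$ for $|i|\gg 0$, and *homologically finite*, written $X\in D^f_b(R)$, if $\bigoplus_{i\in\mathbb Z}H_i(X)$ is a finitely generated $R$-module. For $X\in D^f_b(R)$ write $\operatorname{pd}_R(X)<\infty$ if $X$ is isomorphic in $D(R)$ to a bounded complex of projective $R$-modules. A complex $M\in D^f_b(R)$ is a *$\operatorname{pd}$-test complex over $R$* if every $N\in D^f_b(R)$ for which $M\otimes^{\mathbf L}_R N$ is homologically bounded satisfies $\operatorname{pd}_R(N)<\infty$. **Theorem.** Let $\varphi\colon(R,\mathfrak m)\to(S,\mathfrak n)$ be a flat local homomorphism of commutative noetherian local rings such that $\mathfrak mS=\mathfrak n$ and the induced map $R/\mathfrak m\to S/\mathfrak n$ is a finite field extension. Let $M\in D^f_b(R)$. Then $M$ is a $\operatorname{pd}$-test complex over $R$ if and only if $S\otimes^{\mathbf L}_R M$ is a $\operatorname{pd}$-test complex over $S$. -/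

import Mathlib

open CategoryTheory Limits

universe w w' u

noncomputable section

/-! ### Projective resolutions of complexes that are bounded on the right -/

namespace CochainComplex

variable {C : Type*} [Category* C] [Abelian C]

/-- Reindexing by `n ↦ -n` preserves quasi-isomorphisms. -/
lemma quasiIso_restrictionMap_neg {K L : CochainComplex C ℤ} (φ : K ⟶ L) [QuasiIso φ] :
    QuasiIso (HomologicalComplex.restrictionMap φ ComplexShape.embeddingDownIntUpInt) where
  quasiIsoAt i := by
    rw [quasiIsoAt_iff' _ (i + 1) i (i - 1) (by simp) (by simp)]
    have h : QuasiIsoAt φ (-i) := inferInstance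
    rw [quasiIsoAt_iff' _ (-(i + 1)) (-i) (-(i - 1)) (by simp; lia) (by simp; lia)] at h
    exact h

/-- In an abelian category with enough projectives, every cochain complex that vanishes in
cohomological degrees `> n` receives a quasi-isomorphism from a complex of projectives that
vanishes in degrees `> n`. -/
lemma exists_quasiIso_projective [EnoughProjectives C] (K : CochainComplex C ℤ) (n : ℤ)
    [K.IsStrictlyLE n] :
    ∃ (P : CochainComplex C ℤ) (π : P ⟶ K), QuasiIso π ∧ (∀ i, Projective (P.X i)) ∧
      P.IsStrictlyLE n := by
  let K' : CochainComplex Cᵒᵖ ℤ := (opEquivalence C).functor.obj (Opposite.op K)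
  have hK' : K'.IsStrictlyGE (-n) := by
    rw [isStrictlyGE_iff]
    intro i hi
    exact (K.isZero_of_isStrictlyLE n (-i) (by lia)).op
  obtain ⟨L, i, hi, hL, hL'⟩ :=
    Plus.modelCategoryQuillen.exists_quasiIso_injective K' (-n)
  have := quasiIso_restrictionMap_neg i
  let e := ((opEquivalence C).unitIso.app (Opposite.op K)).unop
  let j : ((opEquivalence C).inverse.obj L).unop ⟶ ((opEquivalence C).inverse.obj K').unop :=
    ((opEquivalence C).inverse.map i).unop
  have hj : QuasiIso j :=
    (HomologicalComplex.quasiIso_unopFunctor_map_iff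
      (HomologicalComplex.restrictionMap i ComplexShape.embeddingDownIntUpInt)).2 this
  refine ⟨((opEquivalence C).inverse.obj L).unop, j ≫ e.hom, inferInstance, fun m ↦ ?_, ?_⟩
  · have := hL (-m)
    exact (inferInstance : Projective (Opposite.unop (L.X (-m))))
  · rw [isStrictlyLE_iff]
    intro m hm
    exact (L.isZero_of_isStrictlyGE (-n) (-m) (by lia)).unop

end CochainComplex

namespace DerivedCategory

/-! The derived category `D(R)` is `DerivedCategory (ModuleCat R)`. Mathlib indexes complexes
cohomologically; a complex with homological indexing is turned into one of these by
`X_i = X^{-i}`, so that `H_i(X) = H^{-i}(X)`. -/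

section

variable {R : Type u} [CommRing R] [HasDerivedCategory.{w} (ModuleCat.{u} R)]

/-- The homology module `H_i(X)` of `X` in `D(R)`. -/
def homologyModule (X : DerivedCategory (ModuleCat.{u} R)) (i : ℤ) : ModuleCat.{u} R :=
  (homologyFunctor (ModuleCat.{u} R) (-i)).obj X

/-- `X` is bounded on the right: `H_i(X) = 0` for `i ≪ 0`. -/
def IsRightBounded (X : DerivedCategory (ModuleCat.{u} R)) : Prop :=
  ∃ n : ℤ, ∀ i : ℤ, i < n → IsZero (X.homologyModule i)

/-- `X` is homologically bounded: `H_i(X) = 0` for `|i| ≫ 0`. -/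
def IsHomologicallyBounded (X : DerivedCategory (ModuleCat.{u} R)) : Prop :=
  ∃ n : ℤ, ∀ i : ℤ, n < |i| → IsZero (X.homologyModule i)

/-- `X` is homologically finite: `H(X) = ⨁ i, H_i(X)` is a finitely generated module. -/
def IsHomologicallyFinite (X : DerivedCategory (ModuleCat.{u} R)) : Prop :=
  Module.Finite R (DirectSum ℤ fun i ↦ X.homologyModule i)

lemma IsHomologicallyBounded.isRightBounded {X : DerivedCategory (ModuleCat.{u} R)}
    (hX : X.IsHomologicallyBounded) : X.IsRightBounded := by
  obtain ⟨n, hn⟩ := hX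
  exact ⟨-n, fun i hi ↦ hn i (by have := neg_abs_le i; lia)⟩

lemma IsHomologicallyFinite.isHomologicallyBounded {X : DerivedCategory (ModuleCat.{u} R)}
    (hX : X.IsHomologicallyFinite) : X.IsHomologicallyBounded := by
  classical
  obtain ⟨s, hs⟩ := hX.fg_top
  let t : Finset ℤ := s.biUnion fun x ↦ DFinsupp.support x
  have ht (x : DirectSum ℤ fun i ↦ X.homologyModule i) (i : ℤ) (hi : i ∉ t) : x i = 0 := by
    have hle : Submodule.span R (s : Set (DirectSum ℤ fun i ↦ X.homologyModule i)) ≤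
        LinearMap.ker (DirectSum.component R ℤ (fun i ↦ X.homologyModule i) i) := by
      rw [Submodule.span_le]
      intro y hy
      by_contra hne
      exact hi (Finset.mem_biUnion.2 ⟨y, hy, DFinsupp.mem_support_iff.2 hne⟩)
    exact hle (hs ▸ Submodule.mem_top : x ∈ Submodule.span R _)
  refine ⟨∑ i ∈ t, |i|, fun i hi ↦ ?_⟩
  have hit : i ∉ t := fun h ↦
    absurd (Finset.single_le_sum (f := fun j : ℤ ↦ |j|) (fun _ _ ↦ abs_nonneg _) h) (not_le.2 hi)
  rw [ModuleCat.isZero_iff_subsingleton]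
  refine subsingleton_of_forall_eq 0 fun m ↦ ?_
  simpa using ht (DirectSum.lof R ℤ (fun i ↦ X.homologyModule i) i m) i hit

lemma IsHomologicallyFinite.isRightBounded {X : DerivedCategory (ModuleCat.{u} R)}
    (hX : X.IsHomologicallyFinite) : X.IsRightBounded :=
  hX.isHomologicallyBounded.isRightBounded

/-- A projective resolution of `X` in `D(R)`: a complex `P` of projective modules, with `P_i = 0`
for `i ≪ 0`, together with an isomorphism from `P` to `X` in `D(R)`. -/
structure ProjRes (X : DerivedCategory (ModuleCat.{u} R)) where
  /-- the complex of projective modules -/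
  P : CochainComplex (ModuleCat.{u} R) ℤ
  projective (i : ℤ) : Projective (P.X i)
  bounded : ∃ n : ℤ, P.IsStrictlyLE n
  /-- the isomorphism in the derived category -/
  iso : Q.obj P ≅ X

lemma IsRightBounded.nonempty_projRes {X : DerivedCategory (ModuleCat.{u} R)}
    (hX : X.IsRightBounded) : Nonempty X.ProjRes := by
  obtain ⟨n, hn⟩ := hX
  have : X.IsLE (-n) := by
    rw [isLE_iff]
    intro i hi
    have := hn (-i) (by lia)
    rwa [homologyModule, neg_neg] at this
  obtain ⟨K, _, ⟨e⟩⟩ := X.exists_iso_Q_obj_of_isLE (-n)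
  obtain ⟨P, π, _, hP, hP'⟩ := CochainComplex.exists_quasiIso_projective K (-n)
  exact ⟨⟨P, hP, ⟨_, hP'⟩, asIso (Q.map π) ≪≫ e.symm⟩⟩

/-- A chosen projective resolution of an object of `D(R)` that is bounded on the right. -/
def IsRightBounded.projRes {X : DerivedCategory (ModuleCat.{u} R)}
    (hX : X.IsRightBounded) : X.ProjRes :=
  hX.nonempty_projRes.some

/-- The derived tensor product `X ⊗ᴸ Y` in `D(R)` of objects that are bounded on the right: the
total complex of the tensor product of projective resolutions of `X` and of `Y`. -/
def derivedTensor {X Y : DerivedCategory (ModuleCat.{u} R)} (hX : X.IsRightBounded)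
    (hY : Y.IsRightBounded) : DerivedCategory (ModuleCat.{u} R) :=
  Q.obj (HomologicalComplex.tensorObj hX.projRes.P hY.projRes.P)

/-- `pd_R(X) ≤ n`: there is a projective resolution `P` of `X` with `P_i = 0` for all `i > n`. -/
def HasProjDimLE (X : DerivedCategory (ModuleCat.{u} R)) (n : ℤ) : Prop :=
  ∃ P : X.ProjRes, ∀ i : ℤ, n < i → IsZero (P.P.X (-i))

/-- `pd_R(X) < ∞`. -/
def HasFiniteProjDim (X : DerivedCategory (ModuleCat.{u} R)) : Prop :=
  ∃ n : ℤ, X.HasProjDimLE n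

/-- `M` is a `pd`-test complex over `R`: it is homologically finite, and every homologically
finite `N` such that `M ⊗ᴸ N` is homologically bounded has finite projective dimension. -/
def IsPdTestComplex (M : DerivedCategory (ModuleCat.{u} R)) : Prop :=
  ∃ hM : M.IsHomologicallyFinite,
    ∀ (N : DerivedCategory (ModuleCat.{u} R)) (hN : N.IsHomologicallyFinite),
      (derivedTensor hM.isRightBounded hN.isRightBounded).IsHomologicallyBounded →
        N.HasFiniteProjDim

end

section

variable {R S : Type u} [CommRing R] [CommRing S] (φ : R →+* S)

instance : (ModuleCat.extendScalars.{u, u, u} φ).Additive :=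
  (ModuleCat.extendRestrictScalarsAdj.{u, u, u} φ).left_adjoint_additive

/-- The derived base change `S ⊗ᴸ_R X` in `D(S)` along `φ : R →+* S`, for `X` in `D(R)` bounded
on the right: extend scalars termwise in a projective resolution of `X`. -/
def derivedBaseChange [HasDerivedCategory.{w} (ModuleCat.{u} R)]
    [HasDerivedCategory.{w'} (ModuleCat.{u} S)]
    {X : DerivedCategory (ModuleCat.{u} R)} (hX : X.IsRightBounded) :
    DerivedCategory (ModuleCat.{u} S) :=
  Q.obj (((ModuleCat.extendScalars.{u, u, u} φ).mapHomologicalComplex (.up ℤ)).obj hX.projRes.P)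

end

end DerivedCategory

end

/-! Write `k` and `ℓ` for the residue fields of `R` and `S`. Over a noetherian local ring, a
homologically finite `N` has finite projective dimension as soon as `k ⊗ᴸ N` is bounded
(`hasFiniteProjDim_of_hasBoundedHomology`), and finite projective dimension makes `Z ⊗ᴸ N` bounded
for every module `Z`. Both implications are tested on residue fields, where `𝔪S = 𝔫` gives `S ⊗ k ≅
ℓ`.

Descent. If `M ⊗ᴸ N` is bounded, then by flatness so is `S ⊗ (M ⊗ᴸ N) ≅ (S ⊗ M) ⊗ᴸ (S ⊗ N)`. Hence
`S ⊗ N` has finite projective dimension, so `(S ⊗ k) ⊗ᴸ (S ⊗ N) ≅ S ⊗ (k ⊗ᴸ N)` is bounded. A flat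
local homomorphism is faithfully flat, so `k ⊗ᴸ N` is bounded.

Ascent. Let `(S ⊗ M) ⊗ᴸ N` be bounded, with `N` over `S`. Restricted to `R`, `N` need not be
homologically finite, so it is replaced by its Koszul complex `K` on generators of `𝔫` coming from
`𝔪`. The homology of `K` is finitely generated and `𝔫`-power torsion over `S`, hence finitely
generated over `R` because `ℓ` is finite over `k`. The projection formula `M ⊗ᴸ K ≅ (S ⊗ M) ⊗ᴸ K`
shows that `M ⊗ᴸ K` is bounded, so `K` has finite projective dimension over `R` and `k ⊗ᴸ K ≅ ℓ ⊗ᴸ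
K` is bounded. The Koszul elements act as zero on `ℓ`, so at each cone of the construction the
homology of the tensored complex is a retract of that of the tensored cone; removing the cones one
by one leaves `ℓ ⊗ᴸ N` bounded.

Derived tensor products are defined by chosen resolutions.
`isHomologicallyBounded_derivedTensor_iff` removes the choice: a projective resolution of one factor
and any complex representing the other suffice. -/

noncomputable section

open MonoidalCategory

/-! ### Complexes with bounded homology, and mapping cones -/

namespace CochainComplex

section

variable {C : Type*} [Category* C] [Abelian C]

/-- The homology of `K` is concentrated in finitely many degrees. -/
def HasBoundedHomology (K : CochainComplex C ℤ) : Prop :=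
  ∃ n : ℤ, ∀ i : ℤ, n < |i| → K.ExactAt i

lemma hasBoundedHomology_of_acyclic {K : CochainComplex C ℤ} (hK : K.Acyclic) :
    K.HasBoundedHomology :=
  ⟨0, fun i _ ↦ hK i⟩

lemma HasBoundedHomology.of_quasiIso {K L : CochainComplex C ℤ} (f : K ⟶ L) [QuasiIso f]
    (hK : K.HasBoundedHomology) : L.HasBoundedHomology := by
  obtain ⟨n, hn⟩ := hK
  exact ⟨n, fun i hi ↦ (exactAt_iff_of_quasiIsoAt f i).1 (hn i hi)⟩

lemma hasBoundedHomology_iff_of_quasiIso {K L : CochainComplex C ℤ} (f : K ⟶ L) [QuasiIso f] :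
    K.HasBoundedHomology ↔ L.HasBoundedHomology := by
  refine ⟨fun h ↦ h.of_quasiIso f, fun ⟨n, hn⟩ ↦ ⟨n, fun i hi ↦ ?_⟩⟩
  exact (exactAt_iff_of_quasiIsoAt f i).2 (hn i hi)

lemma HasBoundedHomology.of_iso {K L : CochainComplex C ℤ} (e : K ≅ L)
    (hK : K.HasBoundedHomology) : L.HasBoundedHomology :=
  hK.of_quasiIso e.hom

lemma hasBoundedHomology_iff_of_iso {K L : CochainComplex C ℤ} (e : K ≅ L) :
    K.HasBoundedHomology ↔ L.HasBoundedHomology :=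
  ⟨fun h ↦ h.of_iso e, fun h ↦ h.of_iso e.symm⟩

lemma exactAt_shift_iff (K : CochainComplex C ℤ) (a i j : ℤ) (h : a + i = j) :
    (K⟦a⟧).ExactAt i ↔ K.ExactAt j := by
  simp only [HomologicalComplex.exactAt_iff_isZero_homology]
  exact (((HomologicalComplex.homologyFunctor C (.up ℤ) 0).shiftIso a i j h).app K).isZero_iff

lemma HasBoundedHomology.shift {K : CochainComplex C ℤ} (hK : K.HasBoundedHomology) (a : ℤ) :
    (K⟦a⟧).HasBoundedHomology := by
  obtain ⟨n, hn⟩ := hK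
  refine ⟨n + |a|, fun i hi ↦ (exactAt_shift_iff K a i _ rfl).2 (hn _ ?_)⟩
  have := abs_sub_abs_le_abs_sub i (-a)
  rw [abs_neg, sub_neg_eq_add] at this
  rw [add_comm a i]
  linarith

lemma hasBoundedHomology_shift_iff (K : CochainComplex C ℤ) (a : ℤ) :
    (K⟦a⟧).HasBoundedHomology ↔ K.HasBoundedHomology :=
  ⟨fun h ↦ (h.shift (-a)).of_iso ((shiftEquiv _ a).unitIso.symm.app K), fun h ↦ h.shift a⟩

section ShortExact

variable {S : ShortComplex (CochainComplex C ℤ)} (hS : S.ShortExact)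
include hS

lemma HasBoundedHomology.of_shortExact₂ (h₁ : S.X₁.HasBoundedHomology)
    (h₃ : S.X₃.HasBoundedHomology) : S.X₂.HasBoundedHomology := by
  obtain ⟨n, hn⟩ := h₁
  obtain ⟨m, hm⟩ := h₃
  refine ⟨max n m, fun i hi ↦ ?_⟩
  rw [HomologicalComplex.exactAt_iff_isZero_homology]
  exact (hS.homology_exact₂ i).isZero_of_both_zeros
    (((hn i (by grind)).isZero_homology).eq_of_src _ _)
    (((hm i (by grind)).isZero_homology).eq_of_tgt _ _)

lemma HasBoundedHomology.of_shortExact₃ (h₁ : S.X₁.HasBoundedHomology)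
    (h₂ : S.X₂.HasBoundedHomology) : S.X₃.HasBoundedHomology := by
  obtain ⟨n, hn⟩ := h₁
  obtain ⟨m, hm⟩ := h₂
  -- The extra 1 absorbs the degree shift of the connecting homomorphism.
  refine ⟨max n m + 1, fun i hi ↦ ?_⟩
  rw [HomologicalComplex.exactAt_iff_isZero_homology]
  exact (hS.homology_exact₃ i (i + 1) (by simp)).isZero_of_both_zeros
    (((hm i (by grind)).isZero_homology).eq_of_src _ _)
    (((hn (i + 1) (by grind)).isZero_homology).eq_of_tgt _ _)

lemma HasBoundedHomology.of_shortExact₁ (h₂ : S.X₂.HasBoundedHomology)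
    (h₃ : S.X₃.HasBoundedHomology) : S.X₁.HasBoundedHomology := by
  obtain ⟨n, hn⟩ := h₃
  obtain ⟨m, hm⟩ := h₂
  refine ⟨max n m + 1, fun i hi ↦ ?_⟩
  rw [HomologicalComplex.exactAt_iff_isZero_homology]
  exact (hS.homology_exact₁ (i - 1) i (by simp)).isZero_of_both_zeros
    (((hn (i - 1) (by grind)).isZero_homology).eq_of_src _ _)
    (((hm i (by grind)).isZero_homology).eq_of_tgt _ _)

end ShortExact

lemma shortExact_of_degreewise_splitting (S : ShortComplex (CochainComplex C ℤ))
    (σ : ∀ n, (S.map (HomologicalComplex.eval C (.up ℤ) n)).Splitting) : S.ShortExact :=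
  HomologicalComplex.shortExact_of_degreewise_shortExact _ fun n ↦ (σ n).shortExact

-- The cone completes `Q.map f` to a distinguished triangle, so it vanishes in the derived category
-- exactly when `Q.map f` is invertible. Vanishing there is the same as acyclicity.
open ZeroObject in
lemma mappingCone_acyclic_iff {K L : CochainComplex C ℤ} (f : K ⟶ L) :
    (mappingCone f).Acyclic ↔ QuasiIso f := by
  let _ := HasDerivedCategory.standard C
  have hT : DerivedCategory.Q.mapTriangle.obj (mappingCone.triangle f) ∈
      Pretriangulated.distinguishedTriangles :=
    DerivedCategory.mem_distTriang_iff _ |>.2 ⟨_, _, f, ⟨Iso.refl _⟩⟩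
  rw [← DerivedCategory.isIso_Q_map_iff_quasiIso]
  refine Iff.trans ?_ (Pretriangulated.Triangle.isZero₃_iff_isIso₁ _ hT)
  have h (i : ℤ) : IsZero ((DerivedCategory.homologyFunctor C i).obj
      (DerivedCategory.Q.obj (mappingCone f))) ↔ (mappingCone f).ExactAt i := by
    rw [HomologicalComplex.exactAt_iff_isZero_homology]
    exact ((DerivedCategory.homologyFunctorFactors C i).app (mappingCone f)).isZero_iff
  refine ⟨fun hK ↦ ?_, fun h₀ i ↦ (h i).1 ((DerivedCategory.homologyFunctor C i).map_isZero h₀)⟩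
  obtain ⟨g⟩ : Nonempty (mappingCone f ⟶ (0 : CochainComplex C ℤ)) := ⟨0⟩
  have hg : QuasiIso g := ⟨fun i ↦ by
    rw [quasiIsoAt_iff_exactAt _ _ (hK i)]
    exact HomologicalComplex.ExactAt.of_isZero
      ((HomologicalComplex.eval C (.up ℤ) i).map_isZero (isZero_zero _))⟩
  let e : DerivedCategory.Q.obj (mappingCone f) ≅ DerivedCategory.Q.obj 0 :=
    @asIso _ _ _ _ (DerivedCategory.Q.map g) ((DerivedCategory.isIso_Q_map_iff_quasiIso C g).2 hg)
  exact (DerivedCategory.Q.map_isZero (isZero_zero _)).of_iso e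

lemma mappingCone_acyclic {K L : CochainComplex C ℤ} (f : K ⟶ L) [hf : QuasiIso f] :
    (mappingCone f).Acyclic :=
  (mappingCone_acyclic_iff f).2 hf

end

end CochainComplex

namespace DerivedCategory

variable {R : Type u} [CommRing R] [HasDerivedCategory.{w} (ModuleCat.{u} R)]

lemma isHomologicallyBounded_Q_obj_iff (K : CochainComplex (ModuleCat.{u} R) ℤ) :
    (Q.obj K).IsHomologicallyBounded ↔ K.HasBoundedHomology := by
  have key (i : ℤ) : IsZero ((Q.obj K).homologyModule i) ↔ K.ExactAt (-i) := by
    rw [HomologicalComplex.exactAt_iff_isZero_homology]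
    exact ((homologyFunctorFactors (ModuleCat.{u} R) (-i)).app K).isZero_iff
  refine exists_congr fun n ↦ ⟨fun h i hi ↦ ?_, fun h i hi ↦ ?_⟩
  · simpa using (key (-i)).1 (h (-i) (by simpa))
  · exact (key i).2 (h (-i) (by simpa))

end DerivedCategory

/-! ### Total complexes filtered by the first degree -/

namespace CochainComplex

section ElementwiseTotal

variable {C₁ C₂ : Type*} [Category* C₁] [Category* C₂] [Preadditive C₁] [Preadditive C₂]
  {R : Type u} [Ring R] (F : C₁ ⥤ C₂ ⥤ ModuleCat.{u} R) [F.Additive] [∀ X, (F.obj X).Additive]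
  (K : CochainComplex C₁ ℤ) (L : CochainComplex C₂ ℤ)

/-- The submodule of the degree `n` part of the total complex generated by the summands
whose first degree is at least `p`. -/
def totalFiltration (p n : ℤ) : Submodule R ((mapBifunctor K L F).X n) :=
  ⨆ (i : ℤ) (_ : p ≤ i), LinearMap.range (ιMapBifunctor K L F i (n - i) n (by lia)).hom

/-- The projection of the degree `n` part of the total complex to one of its summands. -/
def totalProj (p q n : ℤ) : (mapBifunctor K L F).X n ⟶ (F.obj (K.X p)).obj (L.X q) :=
  HomologicalComplex.mapBifunctorDesc fun p' q' _ ↦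
    if h : p' = p ∧ q' = q then
      eqToHom (by rw [h.1, h.2]) else 0

variable {F K L}

lemma ι_totalProj_self (p q n : ℤ) (h : p + q = n) :
    ιMapBifunctor K L F p q n h ≫ totalProj F K L p q n = 𝟙 _ := by
  simp [totalProj]

lemma ι_totalProj_of_ne (p q p' q' n : ℤ) (h : p' + q' = n) (hp : p' ≠ p) :
    ιMapBifunctor K L F p' q' n h ≫ totalProj F K L p q n = 0 := by
  simp [totalProj, hp]

lemma ι_mem_totalFiltration {p i j n : ℤ} (h : i + j = n) (hi : p ≤ i)
    (x : (F.obj (K.X i)).obj (L.X j)) :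
    (ιMapBifunctor K L F i j n h).hom x ∈ totalFiltration F K L p n := by
  obtain rfl : j = n - i := by lia
  exact Submodule.mem_iSup_of_mem i (Submodule.mem_iSup_of_mem hi ⟨x, rfl⟩)

lemma totalFiltration_le {p n : ℤ} {N : Submodule R ((mapBifunctor K L F).X n)}
    (h : ∀ i j (hij : i + j = n) (_ : p ≤ i) (x : (F.obj (K.X i)).obj (L.X j)),
      (ιMapBifunctor K L F i j n hij).hom x ∈ N) :
    totalFiltration F K L p n ≤ N := by
  refine iSup_le fun i ↦ iSup_le fun hi ↦ ?_
  rintro _ ⟨x, rfl⟩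
  exact h _ _ _ hi x

/-- An element of a direct sum has only finitely many nonzero components. The filtration decreases
in `p`, so the directed union is indexed by `-p`. -/
lemma exists_mem_totalFiltration {n : ℤ} (z : (mapBifunctor K L F).X n) :
    ∃ p, z ∈ totalFiltration F K L p n := by
  have hdir : Directed (· ≤ ·) fun p : ℤ ↦ totalFiltration F K L (-p) n := by
    refine (Monotone.directed_le ?_)
    intro p p' hpp'
    exact totalFiltration_le fun i j hij hi x ↦ ι_mem_totalFiltration _ (by lia) x
  have htop : (⨆ p : ℤ, totalFiltration F K L (-p) n) = ⊤ := by
    rw [← Submodule.ker_mkQ (⨆ p : ℤ, totalFiltration F K L (-p) n), LinearMap.ker_eq_top]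
    have : ModuleCat.ofHom (⨆ p : ℤ, totalFiltration F K L (-p) n).mkQ = 0 := by
      refine HomologicalComplex.mapBifunctor.hom_ext fun i j hij ↦ ?_
      ext x
      exact (Submodule.Quotient.mk_eq_zero _).2
        (Submodule.mem_iSup_of_mem (-i) (ι_mem_totalFiltration hij (by lia) x))
    exact congr_arg ModuleCat.Hom.hom this
  obtain ⟨p, hp⟩ := (Submodule.mem_iSup_of_directed _ hdir).1 (htop ▸ Submodule.mem_top (x := z))
  exact ⟨-p, hp⟩

lemma totalFiltration_eq_bot {p n : ℤ} (hp : ∀ i, p ≤ i → IsZero (K.X i)) :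
    totalFiltration F K L p n = ⊥ := by
  rw [eq_bot_iff]
  refine totalFiltration_le fun i j hij hi x ↦ ?_
  have h₀ : IsZero ((F.obj (K.X i)).obj (L.X j)) :=
    ((F.flip.obj (L.X j)).map_isZero (hp i hi))
  rw [h₀.eq_of_src (ιMapBifunctor K L F i j n hij) 0]
  simp

/-- The leading component: modulo the next filtration step an element comes from the single summand
of first degree `p`. -/
lemma exists_of_mem_totalFiltration {p q n : ℤ} (hpq : p + q = n) {z : (mapBifunctor K L F).X n}
    (hz : z ∈ totalFiltration F K L p n) :
    ∃ (y : (F.obj (K.X p)).obj (L.X q)), z - (ιMapBifunctor K L F p q n hpq).hom y ∈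
      totalFiltration F K L (p + 1) n := by
  have : totalFiltration F K L p n ≤ totalFiltration F K L (p + 1) n ⊔
      LinearMap.range (ιMapBifunctor K L F p q n hpq).hom := by
    refine totalFiltration_le fun i j hij hi x ↦ ?_
    obtain rfl | hi := hi.eq_or_lt
    · obtain rfl : q = j := by lia
      exact Submodule.mem_sup_right ⟨x, rfl⟩
    · exact Submodule.mem_sup_left (ι_mem_totalFiltration _ (by lia) _)
  obtain ⟨z', hz', _, ⟨y, rfl⟩, rfl⟩ := Submodule.mem_sup.1 (this hz)
  exact ⟨y, by simpa using hz'⟩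

lemma ι_mapBifunctor_d (p q n q' n' : ℤ) (h : p + q = n) (h' : p + q' = n') (hn : n + 1 = n') :
    ιMapBifunctor K L F p q n h ≫ (mapBifunctor K L F).d n n' =
      (F.map (K.d p (p + 1))).app (L.X q) ≫ ιMapBifunctor K L F (p + 1) q n' (by lia) +
      p.negOnePow • (F.obj (K.X p)).map (L.d q q') ≫ ιMapBifunctor K L F p q' n' h' := by
  rw [HomologicalComplex.mapBifunctor.d_eq, Preadditive.comp_add,
    HomologicalComplex.mapBifunctor.ι_D₁, HomologicalComplex.mapBifunctor.ι_D₂,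
    HomologicalComplex.mapBifunctor.d₁_eq K L F (.up ℤ) (i₁ := p) (i₁' := p + 1) rfl q n'
      (show p + 1 + q = n' by lia),
    HomologicalComplex.mapBifunctor.d₂_eq K L F (.up ℤ) p (i₂ := q) (i₂' := q')
      (show q + 1 = q' by lia) n' h']
  simp

lemma ι_d_apply (p q n q' n' : ℤ) (h : p + q = n) (h' : p + q' = n') (hn : n + 1 = n')
    (x : (F.obj (K.X p)).obj (L.X q)) :
    ((mapBifunctor K L F).d n n').hom ((ιMapBifunctor K L F p q n h).hom x) =
      (ιMapBifunctor K L F (p + 1) q n' (by lia)).hom (((F.map (K.d p (p + 1))).app (L.X q)).hom x)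
      + p.negOnePow • (ιMapBifunctor K L F p q' n' h').hom
          (((F.obj (K.X p)).map (L.d q q')).hom x) :=
  congr($(ι_mapBifunctor_d p q n q' n' h h' hn).hom x)

/-- The differential raises the first degree by 0 or 1. -/
lemma d_mem_totalFiltration {p n n' : ℤ} {z : (mapBifunctor K L F).X n}
    (hz : z ∈ totalFiltration F K L p n) (hn : n + 1 = n') :
    ((mapBifunctor K L F).d n n').hom z ∈ totalFiltration F K L p n' := by
  suffices totalFiltration F K L p n ≤
      (totalFiltration F K L p n').comap ((mapBifunctor K L F).d n n').hom from this hz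
  refine totalFiltration_le fun i j hij hi x ↦ ?_
  rw [Submodule.mem_comap, ι_d_apply i j n (j + 1) n' hij (by lia) hn]
  exact add_mem (ι_mem_totalFiltration _ (by lia) _)
    (Submodule.smul_of_tower_mem _ _ (ι_mem_totalFiltration _ hi _))

lemma totalProj_eq_zero {p q n : ℤ} {z : (mapBifunctor K L F).X n}
    (hz : z ∈ totalFiltration F K L (p + 1) n) : (totalProj F K L p q n).hom z = 0 := by
  suffices totalFiltration F K L (p + 1) n ≤ LinearMap.ker (totalProj F K L p q n).hom from this hz
  refine totalFiltration_le fun i j hij hi x ↦ ?_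
  exact congr($(ι_totalProj_of_ne p q i j n hij (by lia)).hom x)

/-- If `K` is bounded above and `F.obj (K.X p)` sends `L` to an acyclic complex for all `p`, then
the total complex of the bicomplex obtained by applying `F` to `K` and `L` is acyclic. -/
lemma mapBifunctor_acyclic (b : ℤ) [K.IsStrictlyLE b]
    (h : ∀ p, (((F.obj (K.X p)).mapHomologicalComplex (.up ℤ)).obj L).Acyclic) :
    (mapBifunctor K L F).Acyclic := by
  intro n
  rw [HomologicalComplex.exactAt_iff' _ (n - 1) n (n + 1) (by simp) (by simp),
    ShortComplex.moduleCat_exact_iff]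
  intro z hz
  dsimp at z hz
  -- Induction on the number of filtration steps before the bound `b` of `K`: the leading component
  -- of a cycle is a cycle in its column, hence a boundary there, and subtracting a boundary of the
  -- total complex moves the cycle one step further.
  have key (m : ℕ) : ∀ (p : ℤ) (_ : b + 1 - p ≤ m) (z : (mapBifunctor K L F).X n)
      (_ : ((mapBifunctor K L F).d n (n + 1)).hom z = 0) (_ : z ∈ totalFiltration F K L p n),
      ∃ w, ((mapBifunctor K L F).d (n - 1) n).hom w = z := by
    induction m with
    | zero =>
      intro p hp z _ hz
      rw [totalFiltration_eq_bot fun i hi ↦ K.isZero_of_isStrictlyLE b i (by lia)] at hz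
      exact ⟨0, by simpa using hz.symm⟩
    | succ m hm =>
      intro p hp z hz hzp
      obtain ⟨y, hy⟩ := exists_of_mem_totalFiltration (show p + (n - p) = n by lia) hzp
      -- In the summand of bidegree `(p, n - p + 1)`, the equation `d z = 0` involves only the
      -- second differential of `y`, up to sign.
      have hy₀ : ((F.obj (K.X p)).map (L.d (n - p) (n - p + 1))).hom y = 0 := by
        have h₁ := totalProj_eq_zero (q := n - p + 1) (d_mem_totalFiltration hy rfl)
        rw [map_sub, hz, ι_d_apply p (n - p) n (n - p + 1) (n + 1) (by lia) (by lia) rfl, zero_sub,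
          map_neg, map_add, totalProj_eq_zero (ι_mem_totalFiltration _ le_rfl _), zero_add,
          neg_eq_zero] at h₁
        have h₂ := congr($(ι_totalProj_self p (n - p + 1) (n + 1) (by lia) (K := K) (L := L)
          (F := F)).hom (((F.obj (K.X p)).map (L.d (n - p) (n - p + 1))).hom y))
        have h₃ : (totalProj F K L p (n - p + 1) (n + 1)).hom
            ((ιMapBifunctor K L F p (n - p + 1) (n + 1) (by lia)).hom
            (((F.obj (K.X p)).map (L.d (n - p) (n - p + 1))).hom y)) = 0 := by
          obtain h₀ | h₀ := Int.units_eq_one_or p.negOnePow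
          · simpa only [h₀, one_smul] using h₁
          · simpa only [h₀, Units.neg_smul, one_smul, map_neg, neg_eq_zero] using h₁
        exact h₂.symm.trans h₃
      obtain ⟨x, hx⟩ : ∃ x, ((F.obj (K.X p)).map (L.d (n - p - 1) (n - p))).hom x = y := by
        have := h p (n - p)
        rw [HomologicalComplex.exactAt_iff' _ (n - p - 1) (n - p) (n - p + 1) (by simp) (by simp),
          ShortComplex.moduleCat_exact_iff] at this
        exact this y hy₀
      -- The sign cancels the one carried by the second differential in the total complex.
      let x' := p.negOnePow • (ιMapBifunctor K L F p (n - p - 1) (n - 1) (by lia)).hom x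
      have hx'₁ : ((mapBifunctor K L F).d n (n + 1)).hom
          (z - ((mapBifunctor K L F).d (n - 1) n).hom x') = 0 := by
        rw [map_sub, hz, zero_sub, neg_eq_zero]
        exact congr($((mapBifunctor K L F).d_comp_d (n - 1) n (n + 1)).hom x')
      have hx'₂ : z - ((mapBifunctor K L F).d (n - 1) n).hom x' ∈
          totalFiltration F K L (p + 1) n := by
        have h₁ : ((mapBifunctor K L F).d (n - 1) n).hom x' =
            p.negOnePow • (ιMapBifunctor K L F (p + 1) (n - p - 1) n (by lia)).hom
              (((F.map (K.d p (p + 1))).app (L.X (n - p - 1))).hom x) +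
            (ιMapBifunctor K L F p (n - p) n (by lia)).hom y := by
          dsimp only [x']
          rw [Units.smul_def, map_zsmul, ← Units.smul_def,
            ι_d_apply p _ _ (n - p) n (by lia) (by lia) (by lia), hx, smul_add, smul_smul,
            Int.units_mul_self, one_smul]
        rw [h₁, ← sub_sub, sub_right_comm]
        exact sub_mem hy (Submodule.smul_of_tower_mem _ _ (ι_mem_totalFiltration _ le_rfl _))
      obtain ⟨w, hw⟩ := hm (p + 1) (by lia) _ hx'₁ hx'₂
      exact ⟨w + x', by rw [map_add, hw, sub_add_cancel]⟩
  obtain ⟨p, hp⟩ := exists_mem_totalFiltration z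
  exact key (b + 1 - p).toNat p (by lia) z hz hp

end ElementwiseTotal

end CochainComplex

/-! ### Boundedness of total complexes under cones, quasi-isomorphisms and homotopy equivalences -/

namespace CochainComplex

section TotalBounded

variable {C₁ C₂ : Type*} [Category* C₁] [Category* C₂] [Preadditive C₁] [Preadditive C₂]
  {R : Type u} [Ring R] (F : C₁ ⥤ C₂ ⥤ ModuleCat.{u} R) [F.Additive] [∀ X, (F.obj X).Additive]
  (K : CochainComplex C₁ ℤ)

variable {K} in
/-- The map in degree `n` between total complexes which is induced by a family of morphisms in
the second variable. -/
def mapBifunctorGradedMap {L L' : CochainComplex C₂ ℤ} (φ : ∀ q, L.X q ⟶ L'.X q) (n : ℤ) :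
    (mapBifunctor K L F).X n ⟶ (mapBifunctor K L' F).X n :=
  HomologicalComplex.mapBifunctorDesc fun p q h ↦
    (F.obj (K.X p)).map (φ q) ≫ ιMapBifunctor K L' F p q n h

lemma mapBifunctorGradedMap_comp {L L' L'' : CochainComplex C₂ ℤ} (φ : ∀ q, L.X q ⟶ L'.X q)
    (ψ : ∀ q, L'.X q ⟶ L''.X q) (n : ℤ) :
    mapBifunctorGradedMap F (K := K) φ n ≫ mapBifunctorGradedMap F ψ n =
      mapBifunctorGradedMap F (fun q ↦ φ q ≫ ψ q) n :=
  HomologicalComplex.mapBifunctor.hom_ext fun p q h ↦ by simp [mapBifunctorGradedMap]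

lemma mapBifunctorGradedMap_add {L L' : CochainComplex C₂ ℤ} (φ ψ : ∀ q, L.X q ⟶ L'.X q) (n : ℤ) :
    mapBifunctorGradedMap F (K := K) φ n + mapBifunctorGradedMap F ψ n =
      mapBifunctorGradedMap F (fun q ↦ φ q + ψ q) n :=
  HomologicalComplex.mapBifunctor.hom_ext fun p q h ↦ by
    simp [mapBifunctorGradedMap, Functor.map_add]

lemma mapBifunctorGradedMap_id (L : CochainComplex C₂ ℤ) (n : ℤ) :
    mapBifunctorGradedMap F (K := K) (fun q ↦ 𝟙 (L.X q)) n = 𝟙 _ :=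
  HomologicalComplex.mapBifunctor.hom_ext fun p q h ↦ by simp [mapBifunctorGradedMap]

lemma mapBifunctorMap_f_eq {L L' : CochainComplex C₂ ℤ} (f : L ⟶ L') (n : ℤ) :
    (HomologicalComplex.mapBifunctorMap (𝟙 K) f F (.up ℤ)).f n =
      mapBifunctorGradedMap F f.f n :=
  HomologicalComplex.mapBifunctor.hom_ext fun p q h ↦ by
    rw [HomologicalComplex.ι_mapBifunctorMap]
    simp [mapBifunctorGradedMap]

/-- Needed for the image of a short complex under this functor to be a short complex. -/
instance : ((F.map₂HomologicalComplex (.up ℤ) (.up ℤ) (.up ℤ)).obj K :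
    CochainComplex C₂ ℤ ⥤ CochainComplex (ModuleCat.{u} R) ℤ).PreservesZeroMorphisms where
  map_zero L L' := HomologicalComplex.hom_ext _ _ fun n ↦
    (mapBifunctorMap_f_eq F K 0 n).trans
      ((HomologicalComplex.mapBifunctor.hom_ext fun p q h ↦ by
        simp [mapBifunctorGradedMap]) : mapBifunctorGradedMap F _ n = 0)

/-- The total complex of the bicomplex obtained by applying `F` to `K` and to a degreewise split
short complex is degreewise split. -/
def mapBifunctorSplitting (S : ShortComplex (CochainComplex C₂ ℤ))
    (σ : ∀ n, (S.map (HomologicalComplex.eval C₂ (.up ℤ) n)).Splitting) (n : ℤ) :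
    ((S.map ((F.map₂HomologicalComplex (.up ℤ) (.up ℤ) (.up ℤ)).obj K)).map
      (HomologicalComplex.eval (ModuleCat.{u} R) (.up ℤ) n)).Splitting :=
  -- The degreewise retractions and sections are not chain maps, so only their graded counterparts
  -- on total complexes are available.
  let r (q : ℤ) : S.X₂.X q ⟶ S.X₁.X q := (σ q).r
  let s (q : ℤ) : S.X₃.X q ⟶ S.X₂.X q := (σ q).s
  have hr (q : ℤ) : S.f.f q ≫ r q = 𝟙 _ := (σ q).f_r
  have hs (q : ℤ) : s q ≫ S.g.f q = 𝟙 _ := (σ q).s_g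
  have hid (q : ℤ) : r q ≫ S.f.f q + S.g.f q ≫ s q = 𝟙 _ := (σ q).id
  { r := mapBifunctorGradedMap F r n
    s := mapBifunctorGradedMap F s n
    f_r := by
      have : (HomologicalComplex.mapBifunctorMap (𝟙 K) S.f F (.up ℤ)).f n ≫
          mapBifunctorGradedMap F r n = 𝟙 _ := by
        rw [mapBifunctorMap_f_eq, mapBifunctorGradedMap_comp]
        simp only [hr, mapBifunctorGradedMap_id]
      exact this
    s_g := by
      have : mapBifunctorGradedMap F s n ≫
          (HomologicalComplex.mapBifunctorMap (𝟙 K) S.g F (.up ℤ)).f n = 𝟙 _ := by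
        rw [mapBifunctorMap_f_eq, mapBifunctorGradedMap_comp]
        simp only [hs, mapBifunctorGradedMap_id]
      exact this
    id := by
      have : mapBifunctorGradedMap F r n ≫
          (HomologicalComplex.mapBifunctorMap (𝟙 K) S.f F (.up ℤ)).f n +
          (HomologicalComplex.mapBifunctorMap (𝟙 K) S.g F (.up ℤ)).f n ≫
          mapBifunctorGradedMap F s n = 𝟙 _ := by
        rw [mapBifunctorMap_f_eq, mapBifunctorMap_f_eq, mapBifunctorGradedMap_comp,
          mapBifunctorGradedMap_comp, mapBifunctorGradedMap_add]
        simp only [hid, mapBifunctorGradedMap_id]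
      exact this }

/-- No exactness of `F` is required, since additive functors preserve splittings. -/
lemma shortExact_mapBifunctor (S : ShortComplex (CochainComplex C₂ ℤ))
    (σ : ∀ n, (S.map (HomologicalComplex.eval C₂ (.up ℤ) n)).Splitting) :
    (S.map ((F.map₂HomologicalComplex (.up ℤ) (.up ℤ) (.up ℤ)).obj K)).ShortExact :=
  shortExact_of_degreewise_splitting _ (mapBifunctorSplitting F K S σ)

end TotalBounded

section

variable {C₁ C₂ : Type*} [Category* C₁] [Category* C₂] [Preadditive C₁] [Abelian C₂]
  {R : Type u} [Ring R] (F : C₁ ⥤ C₂ ⥤ ModuleCat.{u} R) [F.Additive] [∀ X, (F.obj X).Additive]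
  (K : CochainComplex C₁ ℤ)

-- The degreewise split sequence `L' → cone f → L⟦1⟧` stays short exact on total complexes; its long
-- exact sequence bounds the middle term.
variable {F K} in
lemma HasBoundedHomology.mapBifunctor_mappingCone {L L' : CochainComplex C₂ ℤ} (f : L ⟶ L')
    (h : (mapBifunctor K L F).HasBoundedHomology) (h' : (mapBifunctor K L' F).HasBoundedHomology) :
    (mapBifunctor K (mappingCone f) F).HasBoundedHomology :=
  HasBoundedHomology.of_shortExact₂
    (shortExact_mapBifunctor F K _ (mappingCone.triangleRotateShortComplexSplitting f)) h'
    ((h.shift 1).of_iso (mapBifunctorShift₂Iso K L F 1).symm)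

lemma hasBoundedHomology_mapBifunctor_iff_of_acyclic {L L' : CochainComplex C₂ ℤ} (f : L ⟶ L')
    (h : (mapBifunctor K (mappingCone f) F).Acyclic) :
    (mapBifunctor K L F).HasBoundedHomology ↔ (mapBifunctor K L' F).HasBoundedHomology := by
  have hS := shortExact_mapBifunctor F K _ (mappingCone.triangleRotateShortComplexSplitting f)
  have hC := hasBoundedHomology_of_acyclic h
  rw [← hasBoundedHomology_shift_iff _ 1,
    ← hasBoundedHomology_iff_of_iso (mapBifunctorShift₂Iso K L F 1)]
  exact ⟨fun h₃ ↦ HasBoundedHomology.of_shortExact₁ hS hC h₃,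
    fun h₁ ↦ HasBoundedHomology.of_shortExact₃ hS h₁ hC⟩

/-- The cone of `f` is acyclic and remains so in each column by exactness of `F.obj (K.X p)`;
`mapBifunctor_acyclic` passes to the total complex. -/
lemma hasBoundedHomology_mapBifunctor_iff_of_quasiIso (b : ℤ) [K.IsStrictlyLE b]
    [∀ p, PreservesFiniteLimits (F.obj (K.X p))] [∀ p, PreservesFiniteColimits (F.obj (K.X p))]
    {L L' : CochainComplex C₂ ℤ} (f : L ⟶ L') [QuasiIso f] :
    (mapBifunctor K L F).HasBoundedHomology ↔ (mapBifunctor K L' F).HasBoundedHomology :=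
  hasBoundedHomology_mapBifunctor_iff_of_acyclic F K f
    (mapBifunctor_acyclic b fun p n ↦ (mappingCone_acyclic f n).map (F.obj (K.X p)))

end

section

variable {C₁ C₂ : Type*} [Category* C₁] [Category* C₂] [Preadditive C₁] [Preadditive C₂]
  {R : Type u} [Ring R] (F : C₁ ⥤ C₂ ⥤ ModuleCat.{u} R) [F.Additive] [∀ X, (F.obj X).Additive]

/-- The total complex of a bifunctor sends homotopy equivalences in the first variable to homotopy
equivalences. -/
def mapBifunctorHomotopyEquiv₁ {K K' : CochainComplex C₁ ℤ} (e : HomotopyEquiv K K')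
    (L : CochainComplex C₂ ℤ) : HomotopyEquiv (mapBifunctor K L F) (mapBifunctor K' L F) where
  hom := HomologicalComplex.mapBifunctorMap e.hom (𝟙 L) F (.up ℤ)
  inv := HomologicalComplex.mapBifunctorMap e.inv (𝟙 L) F (.up ℤ)
  homotopyHomInvId :=
    (Homotopy.ofEq (HomologicalComplex.hom_ext _ _ fun n ↦
      HomologicalComplex.mapBifunctor.hom_ext fun p q h ↦ by simp)).trans
      ((HomologicalComplex.mapBifunctorMapHomotopy₁ e.homotopyHomInvId (𝟙 L) F (.up ℤ)).trans
        (Homotopy.ofEq (HomologicalComplex.hom_ext _ _ fun n ↦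
      HomologicalComplex.mapBifunctor.hom_ext fun p q h ↦ by simp)))
  homotopyInvHomId :=
    (Homotopy.ofEq (HomologicalComplex.hom_ext _ _ fun n ↦
      HomologicalComplex.mapBifunctor.hom_ext fun p q h ↦ by simp)).trans
      ((HomologicalComplex.mapBifunctorMapHomotopy₁ e.homotopyInvHomId (𝟙 L) F (.up ℤ)).trans
        (Homotopy.ofEq (HomologicalComplex.hom_ext _ _ fun n ↦
      HomologicalComplex.mapBifunctor.hom_ext fun p q h ↦ by simp)))

lemma hasBoundedHomology_mapBifunctor_iff_of_homotopyEquiv {K K' : CochainComplex C₁ ℤ}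
    (e : HomotopyEquiv K K') (L : CochainComplex C₂ ℤ) :
    (mapBifunctor K L F).HasBoundedHomology ↔ (mapBifunctor K' L F).HasBoundedHomology := by
  have : QuasiIso (mapBifunctorHomotopyEquiv₁ F e L).hom := inferInstance
  exact hasBoundedHomology_iff_of_quasiIso (mapBifunctorHomotopyEquiv₁ F e L).hom

end

/-! ### Total complexes and coproduct-preserving functors -/

section Comp

variable {C₁ C₂ : Type*} [Category* C₁] [Category* C₂] [Preadditive C₁] [Preadditive C₂]
  {R S : Type u} [Ring R] [Ring S] (F : C₁ ⥤ C₂ ⥤ ModuleCat.{u} R) [F.Additive]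
  [∀ X, (F.obj X).Additive] (G : ModuleCat.{u} R ⥤ ModuleCat.{u} S) [G.Additive]
  [PreservesColimitsOfSize.{0, 0} G]
  (H : C₁ ⥤ C₂ ⥤ ModuleCat.{u} S) [H.Additive] [∀ X, (H.obj X).Additive]
  (e : ∀ X Y, (H.obj X).obj Y ≅ G.obj ((F.obj X).obj Y))
  (e₁ : ∀ {X X'} (f : X ⟶ X') (Y),
    (H.map f).app Y ≫ (e X' Y).hom = (e X Y).hom ≫ G.map ((F.map f).app Y))
  (e₂ : ∀ (X) {Y Y'} (g : Y ⟶ Y'),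
    (H.obj X).map g ≫ (e X Y').hom = (e X Y).hom ≫ G.map ((F.obj X).map g))
  (K : CochainComplex C₁ ℤ) (L : CochainComplex C₂ ℤ)

/-- The comparison map between the total complexes for a composition of functors, in degree `n`. -/
def mapBifunctorCompHom (n : ℤ) :
    (mapBifunctor K L H).X n ⟶ G.obj ((mapBifunctor K L F).X n) :=
  HomologicalComplex.mapBifunctorDesc fun p q h ↦
    (e (K.X p) (L.X q)).hom ≫ G.map (ιMapBifunctor K L F p q n h)

omit [G.Additive] [PreservesColimitsOfSize.{0, 0} G] in
lemma ι_mapBifunctorCompHom (p q n : ℤ) (h : p + q = n) :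
    ιMapBifunctor K L H p q n h ≫ mapBifunctorCompHom F G H e K L n =
      (e (K.X p) (L.X q)).hom ≫ G.map (ιMapBifunctor K L F p q n h) := by
  simp [mapBifunctorCompHom]

omit [PreservesColimitsOfSize.{0, 0} G] in
include e₁ e₂ in
lemma mapBifunctorCompHom_comm (n n' : ℤ) (hn : n + 1 = n') :
    mapBifunctorCompHom F G H e K L n ≫ G.map ((mapBifunctor K L F).d n n') =
      (mapBifunctor K L H).d n n' ≫ mapBifunctorCompHom F G H e K L n' := by
  refine HomologicalComplex.mapBifunctor.hom_ext fun p q h ↦ ?_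
  dsimp at h
  have h₁ := ι_mapBifunctor_d (K := K) (L := L) (F := F) p q n (q + 1) n' h (by lia) hn
  have h₂ := ι_mapBifunctor_d (K := K) (L := L) (F := H) p q n (q + 1) n' h (by lia) hn
  rw [reassoc_of% h₂, reassoc_of% (ι_mapBifunctorCompHom F G H e K L p q n h), ← G.map_comp, h₁]
  simp [ι_mapBifunctorCompHom, reassoc_of% e₁, reassoc_of% e₂, Units.smul_def]

-- As `G` preserves coproducts, `G` of the total complex is in each degree the coproduct of the
-- images of the summands; the inverse comes from its universal property.
omit [G.Additive] in
lemma isIso_mapBifunctorCompHom (n : ℤ) : IsIso (mapBifunctorCompHom F G H e K L n) := by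
  let X := ((GradedObject.mapBifunctor F ℤ ℤ).obj K.X).obj L.X
  have hc : IsColimit (Cofan.mk (G.obj ((mapBifunctor K L F).X n))
      (fun i : ComplexShape.π (.up ℤ) (.up ℤ) (.up ℤ) ⁻¹' {n} ↦
        G.map (ιMapBifunctor K L F i.1.1 i.1.2 n i.2))) :=
    isColimitCofanMkObjOfIsColimit G
      (fun i : ComplexShape.π (.up ℤ) (.up ℤ) (.up ℤ) ⁻¹' {n} ↦ X i.1)
      (fun i ↦ ιMapBifunctor K L F i.1.1 i.1.2 n i.2)
      (GradedObject.isColimitCofanMapObj X (ComplexShape.π (.up ℤ) (.up ℤ) (.up ℤ)) n)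
  let r : G.obj ((mapBifunctor K L F).X n) ⟶ (mapBifunctor K L H).X n :=
    Cofan.IsColimit.desc hc fun i ↦
      (e (K.X i.1.1) (L.X i.1.2)).inv ≫ ιMapBifunctor K L H i.1.1 i.1.2 n i.2
  have hr (p q : ℤ) (h : p + q = n) : G.map (ιMapBifunctor K L F p q n h) ≫ r =
      (e (K.X p) (L.X q)).inv ≫ ιMapBifunctor K L H p q n h :=
    Cofan.IsColimit.fac hc (fun i ↦
      (e (K.X i.1.1) (L.X i.1.2)).inv ≫ ιMapBifunctor K L H i.1.1 i.1.2 n i.2) ⟨(p, q), h⟩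
  refine ⟨r, ?_, ?_⟩
  · refine HomologicalComplex.mapBifunctor.hom_ext fun p q h ↦ ?_
    rw [reassoc_of% (ι_mapBifunctorCompHom F G H e K L p q n h), hr]
    simp
  · refine Cofan.IsColimit.hom_ext hc _ _ fun ⟨⟨p, q⟩, h⟩ ↦ ?_
    have h' : p + q = n := h
    change G.map (ιMapBifunctor K L F p q n h') ≫ r ≫ _ =
      G.map (ιMapBifunctor K L F p q n h') ≫ 𝟙 _
    rw [reassoc_of% (hr p q h'), ι_mapBifunctorCompHom]
    simp

/-- A functor which preserves coproducts commutes with total complexes. -/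
def mapBifunctorCompIso :
    mapBifunctor K L H ≅ (G.mapHomologicalComplex (.up ℤ)).obj (mapBifunctor K L F) :=
  HomologicalComplex.Hom.isoOfComponents
    (fun n ↦ @asIso _ _ _ _ (mapBifunctorCompHom F G H e K L n)
      (isIso_mapBifunctorCompHom F G H e K L n))
    (fun n n' hn ↦ mapBifunctorCompHom_comm F G H e e₁ e₂ K L n n' hn)

end Comp

end CochainComplex

/-! ### Base change of tensor products and the projection formula -/

section BaseChange

variable {R S : Type u} [CommRing R] [CommRing S] (φ : R →+* S)

namespace ModuleCat

/-- The canonical map `X ⊗ Y ⟶ (S ⊗ X) ⊗ Y` which is bijective for `X` an `R`-module and `Y` an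
`S`-module. -/
def projectionFormulaHom (X : ModuleCat.{u} R) (Y : ModuleCat.{u} S) :
    X ⊗ (restrictScalars.{u} φ).obj Y ⟶
      (restrictScalars.{u} φ).obj ((extendScalars.{u, u, u} φ).obj X ⊗ Y) :=
  (extendRestrictScalarsAdj.{u, u, u} φ).unit.app X ▷ _ ≫
    Functor.LaxMonoidal.μ (restrictScalars.{u} φ) _ _

lemma projectionFormulaHom_tmul (X : ModuleCat.{u} R) (Y : ModuleCat.{u} S) (x : X) (y : Y) :
    letI := φ.toAlgebra
    (projectionFormulaHom φ X Y).hom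
        (TensorProduct.tmul R x (show (restrictScalars.{u} φ).obj Y from y)) =
      TensorProduct.tmul S ((TensorProduct.tmul R (1 : S) x :) : (extendScalars.{u, u, u} φ).obj X) y :=
  restrictScalars_μ_tmul φ ((extendScalars.{u, u, u} φ).obj X) Y
    ((extendRestrictScalarsAdj.{u, u, u} φ).unit.app X x) y

/-- On pure tensors the map agrees with the cancellation isomorphism `Y ⊗[S] (S ⊗[R] X) ≃ Y ⊗[R] X`,
up to swapping factors. -/
lemma isIso_projectionFormulaHom (X : ModuleCat.{u} R) (Y : ModuleCat.{u} S) :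
    IsIso (projectionFormulaHom φ X Y) := by
  let := φ.toAlgebra
  rw [ConcreteCategory.isIso_iff_bijective]
  let : Module R Y := Module.compHom Y φ
  have : IsScalarTower R S Y := ⟨fun r s y ↦ by
    rw [Algebra.smul_def, mul_smul]; rfl⟩
  let e : (X ⊗ (restrictScalars.{u} φ).obj Y : ModuleCat.{u} R) →ₗ[R]
      (restrictScalars.{u} φ).obj ((extendScalars.{u, u, u} φ).obj X ⊗ Y) :=
    ((TensorProduct.comm R X Y).trans
    ((((TensorProduct.AlgebraTensorModule.cancelBaseChange R S S Y X).symm.trans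
      (TensorProduct.comm S Y (TensorProduct R S X))).restrictScalars R))).toLinearMap
  have he : Function.Bijective e :=
    ((TensorProduct.comm R X Y).trans
    ((((TensorProduct.AlgebraTensorModule.cancelBaseChange R S S Y X).symm.trans
      (TensorProduct.comm S Y (TensorProduct R S X))).restrictScalars R))).bijective
  have : (projectionFormulaHom φ X Y).hom = e := by
    refine TensorProduct.ext' fun x y ↦ ?_
    exact projectionFormulaHom_tmul φ X Y x y
  rw [← this] at he
  exact he

/-- The canonical isomorphism `X ⊗ Y ≅ (S ⊗ X) ⊗ Y` for `X` an `R`-module and `Y` an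
`S`-module. -/
def projectionFormulaIso (X : ModuleCat.{u} R) (Y : ModuleCat.{u} S) :
    X ⊗ (restrictScalars.{u} φ).obj Y ≅
      (restrictScalars.{u} φ).obj ((extendScalars.{u, u, u} φ).obj X ⊗ Y) :=
  @asIso _ _ _ _ (projectionFormulaHom φ X Y) (isIso_projectionFormulaHom φ X Y)

lemma projectionFormulaIso_naturality_left {X X' : ModuleCat.{u} R} (f : X ⟶ X')
    (Y : ModuleCat.{u} S) :
    f ▷ (restrictScalars.{u} φ).obj Y ≫ (projectionFormulaIso φ X' Y).hom =
      (projectionFormulaIso φ X Y).hom ≫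
        (restrictScalars.{u} φ).map ((extendScalars.{u, u, u} φ).map f ▷ Y) := by
  change f ▷ (restrictScalars.{u} φ).obj Y ≫ projectionFormulaHom φ X' Y =
    projectionFormulaHom φ X Y ≫ _
  dsimp only [projectionFormulaHom]
  rw [← comp_whiskerRight_assoc, Category.assoc, ← Functor.LaxMonoidal.μ_natural_left,
    ← comp_whiskerRight_assoc]
  congr 2

lemma projectionFormulaIso_naturality_right (X : ModuleCat.{u} R) {Y Y' : ModuleCat.{u} S}
    (g : Y ⟶ Y') :
    X ◁ (restrictScalars.{u} φ).map g ≫ (projectionFormulaIso φ X Y').hom =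
      (projectionFormulaIso φ X Y).hom ≫
        (restrictScalars.{u} φ).map ((extendScalars.{u, u, u} φ).obj X ◁ g) := by
  change X ◁ (restrictScalars.{u} φ).map g ≫ projectionFormulaHom φ X Y' =
    projectionFormulaHom φ X Y ≫ _
  dsimp only [projectionFormulaHom]
  rw [Category.assoc, ← Functor.LaxMonoidal.μ_natural_right, whisker_exchange_assoc]
  rfl

/-- The bifunctor `(X, Y) ↦ (S ⊗ X) ⊗ Y`, for `X` an `R`-module and `Y` an `S`-module. -/
abbrev extendScalarsTensor : ModuleCat.{u} R ⥤ ModuleCat.{u} S ⥤ ModuleCat.{u} S :=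
  extendScalars.{u, u, u} φ ⋙ curriedTensor (ModuleCat.{u} S)

/-- The bifunctor `(X, Y) ↦ X ⊗ Y`, for `X` an `R`-module and `Y` an `S`-module. -/
abbrev tensorRestrictScalars : ModuleCat.{u} R ⥤ ModuleCat.{u} S ⥤ ModuleCat.{u} R :=
  curriedTensor (ModuleCat.{u} R) ⋙ (Functor.whiskeringLeft _ _ _).obj (restrictScalars.{u} φ)

/-- The bifunctor `(X, Y) ↦ (S ⊗ X) ⊗ (S ⊗ Y)`, for `R`-modules `X` and `Y`. -/
abbrev extendScalarsTensorExtendScalars : ModuleCat.{u} R ⥤ ModuleCat.{u} R ⥤ ModuleCat.{u} S :=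
  extendScalarsTensor φ ⋙ (Functor.whiskeringLeft _ _ _).obj (extendScalars.{u, u, u} φ)

instance : (tensorRestrictScalars φ).Additive where
  map_add {X X' f g} := by
    ext Y : 2
    exact congr_app ((curriedTensor (ModuleCat.{u} R)).map_add (f := f) (g := g)) _

instance (X : ModuleCat.{u} R) : ((tensorRestrictScalars φ).obj X).Additive :=
  inferInstanceAs (restrictScalars.{u} φ ⋙ tensorLeft X).Additive

instance : (extendScalarsTensorExtendScalars φ).Additive where
  map_add {X X' f g} := by
    ext Y : 2
    exact congr_app ((extendScalarsTensor φ).map_add (f := f) (g := g)) _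

instance (X : ModuleCat.{u} R) : ((extendScalarsTensor φ).obj X).Additive :=
  inferInstanceAs (tensorLeft _).Additive

instance (X : ModuleCat.{u} R) : ((extendScalarsTensorExtendScalars φ).obj X).Additive :=
  inferInstanceAs (extendScalars.{u} φ ⋙ tensorLeft _).Additive

end ModuleCat

namespace CochainComplex

open ModuleCat

/-- Extension of scalars for complexes of modules. -/
abbrev extendScalars (P : CochainComplex (ModuleCat.{u} R) ℤ) :
    CochainComplex (ModuleCat.{u} S) ℤ :=
  ((ModuleCat.extendScalars.{u, u, u} φ).mapHomologicalComplex (.up ℤ)).obj P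

/-- Restriction of scalars for complexes of modules. -/
abbrev restrictScalars (Q : CochainComplex (ModuleCat.{u} S) ℤ) :
    CochainComplex (ModuleCat.{u} R) ℤ :=
  ((ModuleCat.restrictScalars.{u} φ).mapHomologicalComplex (.up ℤ)).obj Q

/-- Extension of scalars commutes with tensor products of complexes. -/
def extendScalarsTensorIso (P Q : CochainComplex (ModuleCat.{u} R) ℤ) :
    HomologicalComplex.tensorObj (extendScalars φ P) (extendScalars φ Q) ≅
      extendScalars φ (HomologicalComplex.tensorObj P Q) :=
  mapBifunctorCompIso (curriedTensor (ModuleCat.{u} R)) (ModuleCat.extendScalars.{u, u, u} φ)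
    (extendScalarsTensorExtendScalars φ)
    (fun X Y ↦ Functor.Monoidal.μIso (ModuleCat.extendScalars.{u, u, u} φ) X Y)
    (fun f Y ↦ Functor.LaxMonoidal.μ_natural_left _ f Y)
    (fun X _ _ g ↦ Functor.LaxMonoidal.μ_natural_right _ X g) P Q

/-- The projection formula for tensor products of complexes. -/
def tensorRestrictScalarsIso (P : CochainComplex (ModuleCat.{u} R) ℤ)
    (Q : CochainComplex (ModuleCat.{u} S) ℤ) :
    HomologicalComplex.tensorObj P (restrictScalars φ Q) ≅
      restrictScalars φ (HomologicalComplex.tensorObj (extendScalars φ P) Q) :=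
  mapBifunctorCompIso (extendScalarsTensor φ) (ModuleCat.restrictScalars.{u} φ)
    (tensorRestrictScalars φ) (projectionFormulaIso φ)
    (projectionFormulaIso_naturality_left φ) (projectionFormulaIso_naturality_right φ) P Q

end CochainComplex

end BaseChange

/-! ### Tensoring a module with a complex of flat modules -/

namespace CochainComplex

variable {R : Type u} [CommRing R]

lemma flat_of_projective (P : ModuleCat.{u} R) [h : Projective P] : Module.Flat R P := by
  have : Module.Projective R P := (IsProjective.iff_projective P).2 h
  infer_instance

lemma _root_.Module.Flat.prod (A B : Type u) [AddCommGroup A] [AddCommGroup B] [Module R A]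
    [Module R B] [Module.Flat R A] [Module.Flat R B] : Module.Flat R (A × B) := by
  rw [Module.Flat.iff_rTensor_preserves_injective_linearMap]
  intro N N' _ _ _ _ f hf
  have h : (TensorProduct.prodRight R R N' A B).toLinearMap ∘ₗ f.rTensor (A × B) =
      LinearMap.prodMap (f.rTensor A) (f.rTensor B) ∘ₗ
        (TensorProduct.prodRight R R N A B).toLinearMap := by
    ext <;> simp
  have hinj : Function.Injective ((TensorProduct.prodRight R R N' A B).toLinearMap ∘ₗ
      f.rTensor (A × B)) := by
    rw [h]
    exact (Function.Injective.prodMap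
      (Module.Flat.rTensor_preserves_injective_linearMap f hf)
      (Module.Flat.rTensor_preserves_injective_linearMap f hf)).comp
        (TensorProduct.prodRight R R N A B).injective
  exact Function.Injective.of_comp hinj

/-- The tensor product of a module with a complex of modules. -/
abbrev tensorModule (Z : ModuleCat.{u} R) (Y : CochainComplex (ModuleCat.{u} R) ℤ) :
    CochainComplex (ModuleCat.{u} R) ℤ :=
  ((tensorLeft Z).mapHomologicalComplex (.up ℤ)).obj Y

/-- A short exact sequence of modules induces a short complex of complexes after tensoring. -/
abbrev tensorModuleShortComplex (S : ShortComplex (ModuleCat.{u} R))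
    (Y : CochainComplex (ModuleCat.{u} R) ℤ) :
    ShortComplex (CochainComplex (ModuleCat.{u} R) ℤ) where
  X₁ := tensorModule S.X₁ Y
  X₂ := tensorModule S.X₂ Y
  X₃ := tensorModule S.X₃ Y
  f := (NatTrans.mapHomologicalComplex ((curriedTensor (ModuleCat.{u} R)).map S.f) (.up ℤ)).app Y
  g := (NatTrans.mapHomologicalComplex ((curriedTensor (ModuleCat.{u} R)).map S.g) (.up ℤ)).app Y
  zero := by
    ext i : 1
    change S.f ▷ Y.X i ≫ S.g ▷ Y.X i = 0
    rw [← comp_whiskerRight, S.zero, MonoidalPreadditive.zero_whiskerRight]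

lemma shortExact_tensorModuleShortComplex {S : ShortComplex (ModuleCat.{u} R)} (hS : S.ShortExact)
    (Y : CochainComplex (ModuleCat.{u} R) ℤ) (hY : ∀ i, Module.Flat R (Y.X i)) :
    (tensorModuleShortComplex S Y).ShortExact :=
  HomologicalComplex.shortExact_of_degreewise_shortExact _ fun i ↦
    hS.map_of_exact (tensorRight (Y.X i))

/-- A bounded above acyclic complex of flat modules stays acyclic after tensoring with a module. -/
lemma acyclic_tensorModule (Y : CochainComplex (ModuleCat.{u} R) ℤ) (b : ℤ) [Y.IsStrictlyLE b]
    (hY : ∀ i, Module.Flat R (Y.X i)) (hac : Y.Acyclic) (Z : ModuleCat.{u} R) :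
    (tensorModule Z Y).Acyclic := by
  -- Dimension shifting downwards from `b`: exactness in degree `i` for `Z` follows from degree `i +
  -- 1` for the kernel of a projective cover map onto `Z`, so all `Z` are treated at once.
  suffices ∀ (n : ℕ) (i : ℤ) (_ : b < i + n) (Z : ModuleCat.{u} R),
      (tensorModule Z Y).ExactAt i from fun i ↦ this (b + 1 - i).toNat i (by lia) Z
  intro n
  induction n with
  | zero =>
    intro i hi Z
    exact HomologicalComplex.ExactAt.of_isZero
      ((tensorLeft Z).map_isZero (Y.isZero_of_isStrictlyLE b i (by simpa using hi)))
  | succ n hn =>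
    intro i hi Z
    let p := Projective.π Z
    have hS : (ShortComplex.mk (kernel.ι p) p (by simp)).ShortExact :=
      { exact := ShortComplex.exact_kernel p }
    have hT := shortExact_tensorModuleShortComplex hS Y hY
    have : Module.Flat R (Projective.over Z : ModuleCat.{u} R) := flat_of_projective _
    rw [HomologicalComplex.exactAt_iff_isZero_homology]
    have h₂ : (tensorModule (Projective.over Z) Y).ExactAt i :=
      (hac i).map (tensorLeft (Projective.over Z))
    exact (hT.homology_exact₃ i (i + 1) (by simp)).isZero_of_both_isZero
      h₂.isZero_homology (hn (i + 1) (by lia) (kernel p)).isZero_homology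

/-- Each term of a mapping cone is a retract of a product. -/
lemma exists_retract_mappingCone {Y Y' : CochainComplex (ModuleCat.{u} R) ℤ} (f : Y ⟶ Y') (i : ℤ) :
    ∃ (s : (mappingCone f).X i →ₗ[R] Y.X (i + 1) × Y'.X i)
      (r : Y.X (i + 1) × Y'.X i →ₗ[R] (mappingCone f).X i), r ∘ₗ s = LinearMap.id := by
  refine ⟨LinearMap.prod ((mappingCone.fst f).1.v i (i + 1) rfl).hom
    ((mappingCone.snd f).v i i (add_zero i)).hom,
    LinearMap.coprod ((mappingCone.inl f).v (i + 1) i (by lia)).hom ((mappingCone.inr f).f i).hom,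
    ?_⟩
  ext x
  exact congr($(mappingCone.id_X f i (i + 1) rfl).hom x)

lemma flat_mappingCone {Y Y' : CochainComplex (ModuleCat.{u} R) ℤ} (f : Y ⟶ Y')
    (hY : ∀ i, Module.Flat R (Y.X i)) (hY' : ∀ i, Module.Flat R (Y'.X i)) (i : ℤ) :
    Module.Flat R ((mappingCone f).X i) := by
  obtain ⟨s, r, h⟩ := exists_retract_mappingCone f i
  have := Module.Flat.prod (R := R) (Y.X (i + 1)) (Y'.X i)
  exact Module.Flat.of_retract s r h

lemma projective_mappingCone {Y Y' : CochainComplex (ModuleCat.{u} R) ℤ} (f : Y ⟶ Y')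
    (hY : ∀ i, Projective (Y.X i)) (hY' : ∀ i, Projective (Y'.X i)) (i : ℤ) :
    Projective ((mappingCone f).X i) := by
  obtain ⟨s, r, h⟩ := exists_retract_mappingCone f i
  have (i : ℤ) : Module.Projective R (Y.X i) := (IsProjective.iff_projective _).2 (hY i)
  have (i : ℤ) : Module.Projective R (Y'.X i) := (IsProjective.iff_projective _).2 (hY' i)
  exact (IsProjective.iff_projective _).1 (Module.Projective.of_split s r h)

lemma finite_mappingCone {Y Y' : CochainComplex (ModuleCat.{u} R) ℤ} (f : Y ⟶ Y')
    (hY : ∀ i, Module.Finite R (Y.X i)) (hY' : ∀ i, Module.Finite R (Y'.X i)) (i : ℤ) :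
    Module.Finite R ((mappingCone f).X i) := by
  obtain ⟨s, r, h⟩ := exists_retract_mappingCone f i
  exact Module.Finite.of_surjective r fun x ↦ ⟨s x, congr($h x)⟩

lemma isStrictlyLE_mappingCone {C : Type*} [Category* C] [Abelian C]
    {Y Y' : CochainComplex C ℤ} (f : Y ⟶ Y')
    (b : ℤ) [Y.IsStrictlyLE b] [Y'.IsStrictlyLE b] : (mappingCone f).IsStrictlyLE b := by
  rw [isStrictlyLE_iff]
  intro i hi
  rw [mappingCone.isZero_X_iff]
  exact ⟨Y.isZero_of_isStrictlyLE b _ (by lia), Y'.isZero_of_isStrictlyLE b _ (by lia)⟩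

/-- Tensoring with a module preserves quasi-isomorphisms between bounded above complexes of flat
modules. -/
lemma quasiIso_tensorModule {Y Y' : CochainComplex (ModuleCat.{u} R) ℤ}
    (b : ℤ) [Y.IsStrictlyLE b] [Y'.IsStrictlyLE b] (hY : ∀ i, Module.Flat R (Y.X i))
    (hY' : ∀ i, Module.Flat R (Y'.X i)) (f : Y ⟶ Y') [QuasiIso f] (Z : ModuleCat.{u} R) :
    QuasiIso (((tensorLeft Z).mapHomologicalComplex (.up ℤ)).map f) := by
  rw [← mappingCone_acyclic_iff]
  have := isStrictlyLE_mappingCone f b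
  have h := acyclic_tensorModule _ b (flat_mappingCone f hY hY') (mappingCone_acyclic f) Z
  exact fun i ↦ (h i).of_iso (mappingCone.mapHomologicalComplexIso f (tensorLeft Z))

end CochainComplex

/-! ### Lifting morphisms from the derived category; exact functors and homology -/

namespace CochainComplex

section

variable {C : Type*} [Category* C] [Abelian C]

/-- Out of a K-projective complex, morphisms in the derived category are homotopy classes of chain
maps. -/
lemma exists_Q_map_eq [HasDerivedCategory C] {P L : CochainComplex C ℤ} [P.IsKProjective]
    (g : DerivedCategory.Q.obj P ⟶ DerivedCategory.Q.obj L) :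
    ∃ f : P ⟶ L, DerivedCategory.Q.map f = g := by
  obtain ⟨f', hf'⟩ := (IsKProjective.Qh_map_bijective P
    ((HomotopyCategory.quotient _ _).obj L)).surjective
      ((DerivedCategory.quotientCompQhIso C).hom.app P ≫ g ≫
        (DerivedCategory.quotientCompQhIso C).inv.app L)
  obtain ⟨f, rfl⟩ := (HomotopyCategory.quotient _ _).map_surjective f'
  refine ⟨f, ?_⟩
  rw [← cancel_epi ((DerivedCategory.quotientCompQhIso C).hom.app P),
    ← DerivedCategory.quotientCompQhIso_hom_naturality, hf']
  simp

lemma exists_quasiIso_of_iso [HasDerivedCategory C] {P L : CochainComplex C ℤ}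
    [P.IsKProjective] (e : DerivedCategory.Q.obj P ≅ DerivedCategory.Q.obj L) :
    ∃ f : P ⟶ L, QuasiIso f := by
  obtain ⟨f, hf⟩ := exists_Q_map_eq e.hom
  exact ⟨f, (DerivedCategory.isIso_Q_map_iff_quasiIso C f).1 (hf ▸ inferInstance)⟩

lemma nonempty_homotopyEquiv_of_iso [HasDerivedCategory C] {P L : CochainComplex C ℤ}
    [P.IsKProjective] [L.IsKProjective] (e : DerivedCategory.Q.obj P ≅ DerivedCategory.Q.obj L) :
    Nonempty (HomotopyEquiv P L) := by
  obtain ⟨f, hf⟩ := exists_quasiIso_of_iso e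
  obtain ⟨h, -⟩ := (IsKProjective.quasiIso_iff f).1 hf
  exact ⟨h⟩

end

section

variable {C D : Type*} [Category* C] [Abelian C] [Category* D] [Abelian D] (G : C ⥤ D)
  [G.Additive] [PreservesFiniteLimits G] [PreservesFiniteColimits G]

/-- Exact functors commute with the homology of complexes. -/
def homologyMapIso (K : CochainComplex C ℤ) (i : ℤ) :
    ((G.mapHomologicalComplex (.up ℤ)).obj K).homology i ≅ G.obj (K.homology i) :=
  (K.sc i).mapHomologyIso G

lemma HasBoundedHomology.map {K : CochainComplex C ℤ} (hK : K.HasBoundedHomology) :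
    HasBoundedHomology ((G.mapHomologicalComplex (.up ℤ)).obj K) := by
  obtain ⟨n, hn⟩ := hK
  exact ⟨n, fun i hi ↦ (hn i hi).map G⟩

/-- Serves for restriction of scalars and for faithfully flat extension, both exact and reflecting
zero objects. -/
lemma HasBoundedHomology.of_map (hG : ∀ X, IsZero (G.obj X) → IsZero X) {K : CochainComplex C ℤ}
    (hK : HasBoundedHomology ((G.mapHomologicalComplex (.up ℤ)).obj K)) :
    K.HasBoundedHomology := by
  obtain ⟨n, hn⟩ := hK
  refine ⟨n, fun i hi ↦ ?_⟩
  rw [HomologicalComplex.exactAt_iff_isZero_homology]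
  exact hG _ ((hn i hi).isZero_homology.of_iso (homologyMapIso G K i).symm)

end

end CochainComplex

/-! ### Homological finiteness, and independence of the derived tensor product from resolutions -/

namespace DerivedCategory

variable {R : Type u} [CommRing R] [HasDerivedCategory.{w} (ModuleCat.{u} R)]

lemma isHomologicallyFinite_Q_obj_iff (K : CochainComplex (ModuleCat.{u} R) ℤ) :
    (Q.obj K).IsHomologicallyFinite ↔
      K.HasBoundedHomology ∧ ∀ i, Module.Finite R (K.homology i) := by
  have e (i : ℤ) : (Q.obj K).homologyModule i ≃ₗ[R] K.homology (-i) :=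
    ((homologyFunctorFactors (ModuleCat.{u} R) (-i)).app K).toLinearEquiv
  refine ⟨fun h ↦ ⟨(isHomologicallyBounded_Q_obj_iff K).1 h.isHomologicallyBounded, fun i ↦ ?_⟩,
    fun ⟨h, hf⟩ ↦ ?_⟩
  · have : Module.Finite R (DirectSum ℤ fun i ↦ (Q.obj K).homologyModule i) := h
    have : Module.Finite R ((Q.obj K).homologyModule (-i)) :=
      Module.Finite.of_surjective
        (DirectSum.component R ℤ (fun i ↦ (Q.obj K).homologyModule i) (-i)) fun x ↦
          ⟨DirectSum.lof R ℤ _ _ x, DirectSum.component.lof_self ..⟩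
    have := Module.Finite.equiv (e (-i))
    rwa [neg_neg] at this
  · classical
    obtain ⟨n, hn⟩ := (isHomologicallyBounded_Q_obj_iff K).2 h
    have (i : ℤ) : Module.Finite R ((Q.obj K).homologyModule i) := Module.Finite.equiv (e i).symm
    refine ⟨?_⟩
    have htop : (⊤ : Submodule R (DirectSum ℤ fun i ↦ (Q.obj K).homologyModule i)) =
        ⨆ i ∈ Finset.Icc (-n) n, LinearMap.range (DirectSum.lof R ℤ _ i) := by
      refine le_antisymm (fun x _ ↦ ?_) le_top
      induction x using DirectSum.induction_on with
      | zero => exact zero_mem _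
      | add x y hx hy => exact add_mem (hx trivial) (hy trivial)
      | of i x =>
        by_cases hi : i ∈ Finset.Icc (-n) n
        · exact Submodule.mem_iSup_of_mem i (Submodule.mem_iSup_of_mem hi ⟨x, rfl⟩)
        · have := ModuleCat.subsingleton_of_isZero (hn i (by
            rw [Finset.mem_Icc] at hi
            by_contra h
            exact hi (abs_le.1 (not_lt.1 h))))
          rw [Subsingleton.elim x 0, map_zero]
          exact zero_mem _
    rw [htop]
    exact Submodule.fg_biSup _ _ fun i _ ↦ Submodule.fg_range _

lemma IsHomologicallyFinite.of_iso {X Y : DerivedCategory (ModuleCat.{u} R)} (e : X ≅ Y)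
    (h : X.IsHomologicallyFinite) : Y.IsHomologicallyFinite := by
  have : Module.Finite R (DirectSum ℤ fun i ↦ X.homologyModule i) := h
  exact Module.Finite.equiv (M := DirectSum ℤ fun i ↦ X.homologyModule i) (DirectSum.congrLinearEquiv fun i ↦
    ((homologyFunctor (ModuleCat.{u} R) (-i)).mapIso e).toLinearEquiv)

lemma ProjRes.isKProjective {X : DerivedCategory (ModuleCat.{u} R)} (P : X.ProjRes) :
    P.P.IsKProjective := by
  obtain ⟨n, hn⟩ := P.bounded
  have := P.projective
  exact CochainComplex.isKProjective_of_projective P.P n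

omit [HasDerivedCategory.{w} (ModuleCat.{u} R)] in
lemma preservesFiniteLimits_curriedTensor (X : ModuleCat.{u} R) [Projective X] :
    PreservesFiniteLimits ((curriedTensor (ModuleCat.{u} R)).obj X) := by
  have := CochainComplex.flat_of_projective X
  infer_instance

/-- Two projective resolutions of `X` are homotopy equivalent, which handles the first factor. The
terms of `P` are flat, so the second factor may change by a quasi-isomorphism. Hence `L` can be
arbitrary, for instance a complex restricted from `S`, whose terms need not be projective over `R`.
-/
lemma isHomologicallyBounded_derivedTensor_iff {X Y : DerivedCategory (ModuleCat.{u} R)}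
    (hX : X.IsRightBounded) (hY : Y.IsRightBounded) (P : CochainComplex (ModuleCat.{u} R) ℤ)
    (n : ℤ) [P.IsStrictlyLE n] (hP : ∀ i, Projective (P.X i)) (eX : Q.obj P ≅ X)
    (L : CochainComplex (ModuleCat.{u} R) ℤ) (eY : Q.obj L ≅ Y) :
    (derivedTensor hX hY).IsHomologicallyBounded ↔
      CochainComplex.HasBoundedHomology (HomologicalComplex.tensorObj P L) := by
  have := CochainComplex.isKProjective_of_projective P n
  have := hX.projRes.isKProjective
  have := hY.projRes.isKProjective
  obtain ⟨e⟩ := CochainComplex.nonempty_homotopyEquiv_of_iso (hX.projRes.iso ≪≫ eX.symm)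
  obtain ⟨f, _⟩ := CochainComplex.exists_quasiIso_of_iso (hY.projRes.iso ≪≫ eY.symm)
  have (i : ℤ) := preservesFiniteLimits_curriedTensor (P.X i)
  rw [derivedTensor, isHomologicallyBounded_Q_obj_iff]
  exact (CochainComplex.hasBoundedHomology_mapBifunctor_iff_of_homotopyEquiv
    (curriedTensor (ModuleCat.{u} R)) e _).trans
      (CochainComplex.hasBoundedHomology_mapBifunctor_iff_of_quasiIso
        (curriedTensor (ModuleCat.{u} R)) P n f)

end DerivedCategory

/-! ### Projectives among finitely generated modules -/

namespace FGModuleCat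

variable {R : Type u} [CommRing R] [IsNoetherianRing R]

lemma surjective_of_epi {X Y : FGModuleCat.{u} R} (f : X ⟶ Y) [Epi f] :
    Function.Surjective f.hom.hom :=
  (ModuleCat.epi_iff_surjective _).1
    (inferInstanceAs (Epi ((forget₂ (FGModuleCat.{u} R) (ModuleCat.{u} R)).map f)))

lemma projective_of_module_projective (P : FGModuleCat.{u} R) [Module.Projective R P.obj] :
    Projective P where
  factors {E X} f e _ := by
    obtain ⟨g, hg⟩ := Module.projective_lifting_property e.hom.hom f.hom.hom (surjective_of_epi e)
    exact ⟨FGModuleCat.ofHom g, by ext x; exact congr($hg x)⟩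

lemma exists_surjective_of_free (M : FGModuleCat.{u} R) :
    ∃ (P : FGModuleCat.{u} R) (_ : Module.Projective R P.obj) (f : P ⟶ M), Epi f := by
  obtain ⟨n, f, hf⟩ := Module.Finite.exists_fin' R M
  let P : FGModuleCat.{u} R := FGModuleCat.of R (Fin n → R)
  refine ⟨P, inferInstanceAs (Module.Projective R (Fin n → R)), FGModuleCat.ofHom f, ?_⟩
  exact (forget₂ (FGModuleCat.{u} R) (ModuleCat.{u} R)).epi_of_epi_map
    ((ModuleCat.epi_iff_surjective _).2 hf)

/-- Allows resolutions to be formed inside finitely generated modules, which keeps every term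
finitely generated. -/
instance : EnoughProjectives (FGModuleCat.{u} R) where
  presentation M := by
    obtain ⟨P, _, f, _⟩ := exists_surjective_of_free M
    exact ⟨{ p := P, projective := projective_of_module_projective P, f := f }⟩

/-- Such an object is a retract of a finitely generated projective module, so lifting against
finitely generated modules already implies lifting against all modules. -/
lemma projective_obj (P : FGModuleCat.{u} R) [Projective P] : Projective P.obj := by
  obtain ⟨P', _, f, _⟩ := exists_surjective_of_free P
  let s := Projective.factorThru (𝟙 P) f
  have hs : s ≫ f = 𝟙 P := Projective.factorThru_comp _ _
  have : Projective P'.obj := (IsProjective.iff_projective _).1 ‹_›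
  exact (Retract.mk (X := P.obj) (Y := P'.obj) s.hom f.hom congr(($hs).hom)).projective

end FGModuleCat

/-! ### Resolutions by finitely generated projective modules -/

namespace DerivedCategory

variable {R : Type u} [CommRing R] [HasDerivedCategory.{w} (ModuleCat.{u} R)]

/-- `X` is isomorphic to a bounded above complex of finitely generated projective modules. -/
def IsPseudoCoherent (X : DerivedCategory (ModuleCat.{u} R)) : Prop :=
  ∃ (L : CochainComplex (ModuleCat.{u} R) ℤ) (n : ℤ), L.IsStrictlyLE n ∧
    (∀ i, Projective (L.X i)) ∧ (∀ i, Module.Finite R (L.X i)) ∧ Nonempty (Q.obj L ≅ X)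

namespace IsPseudoCoherent

lemma of_iso {X Y : DerivedCategory (ModuleCat.{u} R)} (e : X ≅ Y) (hX : X.IsPseudoCoherent) :
    Y.IsPseudoCoherent := by
  obtain ⟨L, n, h₁, h₂, h₃, ⟨e'⟩⟩ := hX
  exact ⟨L, n, h₁, h₂, h₃, ⟨e' ≪≫ e⟩⟩

lemma shift {X : DerivedCategory (ModuleCat.{u} R)} (hX : X.IsPseudoCoherent) (a : ℤ) :
    (X⟦a⟧).IsPseudoCoherent := by
  obtain ⟨L, n, h₁, h₂, h₃, ⟨e⟩⟩ := hX
  exact ⟨L⟦a⟧, n - a, L.isStrictlyLE_shift n a _ (by lia), fun i ↦ h₂ _, fun i ↦ h₃ _,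
    ⟨(Q.commShiftIso a).app L ≪≫ (shiftFunctor _ a).mapIso e⟩⟩

/-- The first morphism of the triangle lifts to a chain map between the resolutions, and its cone
resolves the third object. -/
lemma of_distTriang₃ {T : Pretriangulated.Triangle (DerivedCategory (ModuleCat.{u} R))}
    (hT : T ∈ Pretriangulated.distinguishedTriangles) (h₁ : T.obj₁.IsPseudoCoherent)
    (h₂ : T.obj₂.IsPseudoCoherent) : T.obj₃.IsPseudoCoherent := by
  obtain ⟨K, n, hKn, hK, hK', ⟨e⟩⟩ := h₁
  obtain ⟨L, m, hLm, hL, hL', ⟨e'⟩⟩ := h₂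
  have := CochainComplex.isKProjective_of_projective K n
  obtain ⟨f, hf⟩ := CochainComplex.exists_Q_map_eq (e.hom ≫ T.mor₁ ≫ e'.inv)
  have h : Q.mapTriangle.obj (CochainComplex.mappingCone.triangle f) ∈
      Pretriangulated.distinguishedTriangles :=
    mem_distTriang_iff _ |>.2 ⟨_, _, f, ⟨Iso.refl _⟩⟩
  have e₃ := Pretriangulated.Triangle.π₃.mapIso
    (Pretriangulated.isoTriangleOfIso₁₂ _ _ h hT e e' (by
      change Q.map f ≫ e'.hom = e.hom ≫ T.mor₁
      rw [hf, Category.assoc, Category.assoc, e'.inv_hom_id, Category.comp_id]))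
  have := K.isStrictlyLE_of_le n (max n m) (le_max_left _ _)
  have := L.isStrictlyLE_of_le m (max n m) (le_max_right _ _)
  exact ⟨_, max n m, CochainComplex.isStrictlyLE_mappingCone f _,
    CochainComplex.projective_mappingCone f hK hL, CochainComplex.finite_mappingCone f hK' hL',
    ⟨e₃⟩⟩

lemma of_distTriang₂ {T : Pretriangulated.Triangle (DerivedCategory (ModuleCat.{u} R))}
    (hT : T ∈ Pretriangulated.distinguishedTriangles) (h₁ : T.obj₁.IsPseudoCoherent)
    (h₃ : T.obj₃.IsPseudoCoherent) : T.obj₂.IsPseudoCoherent :=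
  of_distTriang₃ (Pretriangulated.inv_rot_of_distTriang _ hT) (h₃.shift (-1)) h₁

end IsPseudoCoherent

variable [IsNoetherianRing R]

lemma isPseudoCoherent_singleFunctor_obj (M : ModuleCat.{u} R) [Module.Finite R M] (n : ℤ) :
    ((singleFunctor (ModuleCat.{u} R) n).obj M).IsPseudoCoherent := by
  let M' : FGModuleCat.{u} R := FGModuleCat.of R M
  let G := forget₂ (FGModuleCat.{u} R) (ModuleCat.{u} R)
  obtain ⟨P, π, _, hP, hP'⟩ := CochainComplex.exists_quasiIso_projective
    ((CochainComplex.singleFunctor (FGModuleCat.{u} R) n).obj M') n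
  let π' := (G.mapHomologicalComplex (.up ℤ)).map π
  have : QuasiIso π' := inferInstance
  refine ⟨(G.mapHomologicalComplex (.up ℤ)).obj P, n, ?_, fun i ↦ ?_, fun i ↦ ?_,
    ⟨asIso (Q.map π') ≪≫ Q.mapIso ((HomologicalComplex.singleMapHomologicalComplex G _ n).app M') ≪≫
      ((singleFunctorIsoCompQ _ n).app M).symm⟩⟩
  · rw [CochainComplex.isStrictlyLE_iff]
    exact fun i hi ↦ G.map_isZero (P.isZero_of_isStrictlyLE n i hi)
  · exact FGModuleCat.projective_obj (P.X i)
  · exact inferInstanceAs (Module.Finite R (P.X i))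

/-- Induction on the amplitude: the truncation triangle splits off the lowest cohomology module,
which is finitely generated and so has a resolution of the required kind. -/
lemma isPseudoCoherent_of_isGE_of_isLE (n : ℕ) (a b : ℤ) (hn : a + n = b)
    (X : DerivedCategory (ModuleCat.{u} R)) [X.IsGE a] [X.IsLE b]
    (hX : ∀ i, Module.Finite R ((homologyFunctor (ModuleCat.{u} R) i).obj X)) :
    X.IsPseudoCoherent := by
  induction n generalizing a X with
  | zero =>
    obtain rfl : a = b := by simpa using hn
    obtain ⟨M, ⟨e⟩⟩ := exists_iso_singleFunctor_obj_of_isGE_of_isLE X a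
    have e' := ((homologyFunctor (ModuleCat.{u} R) a).mapIso e ≪≫
      (singleFunctorCompHomologyFunctorIso (ModuleCat.{u} R) a).app M).toLinearEquiv
    have := hX a
    have : Module.Finite R M := Module.Finite.equiv e'
    exact (isPseudoCoherent_singleFunctor_obj M a).of_iso e.symm
  | succ n hn' =>
    obtain ⟨Y, Z, hY, hZ, f, g, h, hT⟩ := TStructure.t.exists_triangle X a (a + 1) rfl
    have hY' : Y.IsLE a := ⟨hY⟩
    have hZ' : Z.IsGE (a + 1) := ⟨hZ⟩
    have hYX (i : ℤ) (hi : i ≤ a) : IsIso ((homologyFunctor (ModuleCat.{u} R) i).map f) := by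
      have : Mono ((homologyFunctor (ModuleCat.{u} R) i).map f) := by
        refine (HomologySequence.mono_homologyMap_mor₁_iff _ hT (i - 1) i).2 ?_
        exact (Z.isZero_of_isGE (a + 1) (i - 1) (by lia)).eq_of_src _ _
      have : Epi ((homologyFunctor (ModuleCat.{u} R) i).map f) := by
        refine (HomologySequence.epi_homologyMap_mor₁_iff _ hT i).2 ?_
        exact (Z.isZero_of_isGE (a + 1) i (by lia)).eq_of_tgt _ _
      exact isIso_of_mono_of_epi _
    have hXZ (i : ℤ) (hi : a < i) : IsIso ((homologyFunctor (ModuleCat.{u} R) i).map g) := by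
      have : Mono ((homologyFunctor (ModuleCat.{u} R) i).map g) := by
        refine (HomologySequence.mono_homologyMap_mor₂_iff _ hT i).2 ?_
        exact (Y.isZero_of_isLE a i (by lia)).eq_of_src _ _
      have : Epi ((homologyFunctor (ModuleCat.{u} R) i).map g) := by
        refine (HomologySequence.epi_homologyMap_mor₂_iff _ hT i (i + 1)).2 ?_
        exact (Y.isZero_of_isLE a (i + 1) (by lia)).eq_of_tgt _ _
      exact isIso_of_mono_of_epi _
    have hYa : Y.IsGE a := by
      rw [isGE_iff]
      intro i hi
      have := hYX i hi.le
      exact (X.isZero_of_isGE a i hi).of_iso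
        (asIso ((homologyFunctor (ModuleCat.{u} R) i).map f))
    have hZb : Z.IsLE b := by
      rw [isLE_iff]
      intro i hi
      have := hXZ i (by lia)
      exact (X.isZero_of_isLE b i hi).of_iso
        (asIso ((homologyFunctor (ModuleCat.{u} R) i).map g)).symm
    have hYPC : Y.IsPseudoCoherent := by
      obtain ⟨M, ⟨e⟩⟩ := exists_iso_singleFunctor_obj_of_isGE_of_isLE Y a
      have := hYX a le_rfl
      have e' := ((asIso ((homologyFunctor (ModuleCat.{u} R) a).map f)).symm ≪≫
        (homologyFunctor (ModuleCat.{u} R) a).mapIso e ≪≫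
        (singleFunctorCompHomologyFunctorIso (ModuleCat.{u} R) a).app M).toLinearEquiv
      have := hX a
      have : Module.Finite R M := Module.Finite.equiv e'
      exact (isPseudoCoherent_singleFunctor_obj M a).of_iso e.symm
    refine IsPseudoCoherent.of_distTriang₂ hT hYPC
      (hn' (a + 1) (by push_cast at hn; lia) Z fun i ↦ ?_)
    by_cases hi : a < i
    · have := hXZ i hi
      have := hX i
      exact Module.Finite.equiv
        (asIso ((homologyFunctor (ModuleCat.{u} R) i).map g)).toLinearEquiv
    · have := ModuleCat.subsingleton_of_isZero (Z.isZero_of_isGE (a + 1) i (by lia))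
      infer_instance

lemma IsHomologicallyFinite.isPseudoCoherent {X : DerivedCategory (ModuleCat.{u} R)}
    (hX : X.IsHomologicallyFinite) : X.IsPseudoCoherent := by
  obtain ⟨K, ⟨e⟩⟩ : ∃ K, Nonempty (Q.obj K ≅ X) := ⟨_, ⟨Q.objObjPreimageIso X⟩⟩
  obtain ⟨⟨n, hn⟩, hK⟩ := (isHomologicallyFinite_Q_obj_iff K).1 (hX.of_iso e.symm)
  refine IsPseudoCoherent.of_iso e ?_
  let E (i : ℤ) := (homologyFunctorFactors (ModuleCat.{u} R) i).app K
  have : (Q.obj K).IsGE (-|n|) := by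
    rw [isGE_iff]
    exact fun i hi ↦ (hn i (by grind)).isZero_homology.of_iso (E i)
  have : (Q.obj K).IsLE |n| := by
    rw [isLE_iff]
    exact fun i hi ↦ (hn i (by grind)).isZero_homology.of_iso (E i)
  -- The length of the window from `-|n|` to `|n|`.
  refine isPseudoCoherent_of_isGE_of_isLE (2 * n.natAbs) (-|n|) |n|
    (by have := Int.abs_eq_natAbs n; push_cast; lia) _ fun i ↦ ?_
  have : Module.Finite R ((HomologicalComplex.homologyFunctor (ModuleCat.{u} R) _ i).obj K) := hK i
  exact Module.Finite.equiv (E i).toLinearEquiv.symm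

end DerivedCategory

/-! ### The residue field criterion for finite projective dimension -/

namespace CochainComplex

variable {R : Type u} [CommRing R]

/-- The terms of the canonical truncation are the opcycles in the lowest degree, and the terms of the
complex in higher degrees. -/
lemma projective_truncGE (L : CochainComplex (ModuleCat.{u} R) ℤ) (m : ℤ)
    (hL : ∀ i, Projective (L.X i)) (hm : Projective (L.opcycles m)) (i : ℤ) :
    Projective ((L.truncGE m).X i) := by
  by_cases hi : i < m
  · exact ((L.truncGE m).isZero_of_isStrictlyGE m i hi).projective
  · obtain rfl | hi := (not_lt.1 hi).eq_or_lt
    · exact Projective.of_iso (L.truncGEXIsoOpcycles m).symm hm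
    · exact Projective.of_iso (L.truncGEXIso m i hi).symm (hL i)

variable [IsLocalRing R]

/-- Exactness at `m` over the residue field says that `L.opcycles m → L.X (m + 1)` is injective
modulo the maximal ideal. A map from a finitely generated module to a finite free one with this
property is split injective, so the opcycles are a direct summand of a projective module. -/
lemma projective_opcycles_of_exactAt_residueField (L : CochainComplex (ModuleCat.{u} R) ℤ)
    (hL : ∀ i, Projective (L.X i)) (hL' : ∀ i, Module.Finite R (L.X i)) (m : ℤ)
    (hm : (tensorModule (ModuleCat.of R (IsLocalRing.ResidueField R)) L).ExactAt m) :
    Projective (L.opcycles m) := by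
  have hX (i : ℤ) : Module.Projective R (L.X i) := (IsProjective.iff_projective _).2 (hL i)
  have hfree : Module.Free R (L.X (m + 1)) := Module.free_of_flat_of_isLocalRing
  have hp : Function.Surjective (L.pOpcycles m).hom :=
    (ModuleCat.epi_iff_surjective _).1 inferInstance
  have : Module.Finite R (L.opcycles m) := Module.Finite.of_surjective _ hp
  have hinj : Function.Injective
      ((L.fromOpcycles m (m + 1)).hom.lTensor (IsLocalRing.ResidueField R)) := by
    rw [injective_iff_map_eq_zero]
    intro x hx
    obtain ⟨y, rfl⟩ := LinearMap.lTensor_surjective (IsLocalRing.ResidueField R) hp x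
    rw [HomologicalComplex.exactAt_iff' _ (m - 1) m (m + 1) (by simp) (by simp),
      ShortComplex.moduleCat_exact_iff] at hm
    have hd : (L.fromOpcycles m (m + 1)).hom ∘ₗ (L.pOpcycles m).hom = (L.d m (m + 1)).hom :=
      congr($(L.p_fromOpcycles m (m + 1)).hom)
    have hd' : (L.pOpcycles m).hom ∘ₗ (L.d (m - 1) m).hom = 0 :=
      congr($(L.d_pOpcycles (m - 1) m).hom)
    rw [← LinearMap.comp_apply, ← LinearMap.lTensor_comp, hd] at hx
    obtain ⟨z, rfl⟩ := hm y hx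
    change (LinearMap.lTensor _ _ ∘ₗ LinearMap.lTensor _ (L.d (m - 1) m).hom) z = 0
    rw [← LinearMap.lTensor_comp, hd', LinearMap.lTensor_zero]
    rfl
  obtain ⟨l, hl⟩ := (IsLocalRing.split_injective_iff_lTensor_residueField_injective _).2 hinj
  exact (IsProjective.iff_projective _).1 (Module.Projective.of_split _ l hl)

end CochainComplex

namespace DerivedCategory

variable {R : Type u} [CommRing R] [HasDerivedCategory.{w} (ModuleCat.{u} R)]

/-- A bounded projective resolution maps quasi-isomorphically to `Y`; both are bounded above with
flat terms, so this survives tensoring with `Z`. -/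
lemma HasFiniteProjDim.hasBoundedHomology_tensorModule {N : DerivedCategory (ModuleCat.{u} R)}
    (hN : N.HasFiniteProjDim) (Y : CochainComplex (ModuleCat.{u} R) ℤ) (b : ℤ) [Y.IsStrictlyLE b]
    (hY : ∀ i, Module.Flat R (Y.X i)) (e : Q.obj Y ≅ N) (Z : ModuleCat.{u} R) :
    (CochainComplex.tensorModule Z Y).HasBoundedHomology := by
  obtain ⟨n, P, hP⟩ := hN
  obtain ⟨m, hm⟩ := P.bounded
  have := P.isKProjective
  have := P.projective
  obtain ⟨f, hf⟩ := CochainComplex.exists_quasiIso_of_iso (P.iso ≪≫ e.symm)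
  have := P.P.isStrictlyLE_of_le m (max m b) (le_max_left _ _)
  have := Y.isStrictlyLE_of_le b (max m b) (le_max_right _ _)
  have := CochainComplex.quasiIso_tensorModule (max m b)
    (fun i ↦ CochainComplex.flat_of_projective (P.P.X i)) hY f Z
  refine CochainComplex.HasBoundedHomology.of_quasiIso
    (((tensorLeft Z).mapHomologicalComplex (.up ℤ)).map f) ⟨max |n| |m|, fun i hi ↦ ?_⟩
  refine HomologicalComplex.ExactAt.of_isZero ((tensorLeft Z).map_isZero ?_)
  rcases le_or_gt i m with him | him
  · simpa using hP (-i) (by grind)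
  · exact P.P.isZero_of_isStrictlyLE m i him

variable [IsLocalRing R] [IsNoetherianRing R]

/-- A homologically finite complex over a noetherian local ring has finite projective dimension if
its derived tensor product with the residue field is homologically bounded. -/
lemma hasFiniteProjDim_of_hasBoundedHomology {N : DerivedCategory (ModuleCat.{u} R)}
    (hN : N.IsHomologicallyFinite) (Y : CochainComplex (ModuleCat.{u} R) ℤ) (b : ℤ)
    [Y.IsStrictlyLE b] (hY : ∀ i, Module.Flat R (Y.X i)) (e : Q.obj Y ≅ N)
    (h : (CochainComplex.tensorModule
      (ModuleCat.of R (IsLocalRing.ResidueField R)) Y).HasBoundedHomology) :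
    N.HasFiniteProjDim := by
  obtain ⟨L, n, hLn, hL, hL', ⟨eL⟩⟩ := hN.isPseudoCoherent
  have := CochainComplex.isKProjective_of_projective L n
  obtain ⟨f, hf⟩ := CochainComplex.exists_quasiIso_of_iso (eL ≪≫ e.symm)
  have := L.isStrictlyLE_of_le n (max n b) (le_max_left _ _)
  have := Y.isStrictlyLE_of_le b (max n b) (le_max_right _ _)
  have := CochainComplex.quasiIso_tensorModule (max n b)
    (fun i ↦ CochainComplex.flat_of_projective (L.X i)) hY f
    (ModuleCat.of R (IsLocalRing.ResidueField R))
  obtain ⟨a, ha⟩ := (CochainComplex.hasBoundedHomology_iff_of_quasiIso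
    (((tensorLeft (ModuleCat.of R (IsLocalRing.ResidueField R))).mapHomologicalComplex
      (.up ℤ)).map f)).2 h
  obtain ⟨⟨c, hc⟩, -⟩ := (isHomologicallyFinite_Q_obj_iff L).1 (hN.of_iso eL.symm)
  -- Low enough that `k ⊗ L` is exact in degree `m` and `L` is exact below `m`: the truncation at
  -- `m` then has projective terms and is quasi-isomorphic to `L`.
  let m : ℤ := - max |a| |c| - 1
  have hproj := CochainComplex.projective_truncGE L m hL
    (CochainComplex.projective_opcycles_of_exactAt_residueField L hL hL' m
      (ha m (by grind)))
  have : L.IsGE m := by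
    rw [CochainComplex.isGE_iff]
    exact fun i hi ↦ hc i (by grind)
  refine ⟨-m, ⟨L.truncGE m, hproj, ⟨n, inferInstance⟩, (asIso (Q.map (L.πTruncGE m))).symm ≪≫ eL⟩,
    fun i hi ↦ ?_⟩
  exact (L.truncGE m).isZero_of_isStrictlyGE m (-i) (by lia)

end DerivedCategory

/-! ### Finiteness over `R` and properties of scalar extension -/

/-- A finitely generated module over a local ring `S` which is torsion with respect to generators of
the maximal ideal is finitely generated over any ring over which the residue field of `S` is
finite. -/
lemma Module.finite_of_isTorsion_of_finite_residueField (R : Type*) {S W : Type*} [CommRing R]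
    [CommRing S] [IsLocalRing S] [IsNoetherianRing S] [Algebra R S] [AddCommGroup W] [Module S W]
    [Module R W] [IsScalarTower R S W] [Module.Finite S W]
    [Module.Finite R (IsLocalRing.ResidueField S)] (s : Set S)
    (hs : Ideal.span s = IsLocalRing.maximalIdeal S)
    (hW : ∀ x ∈ s, ∀ z : W, ∃ n : ℕ, x ^ n • z = 0) : Module.Finite R W := by
  let I := Module.annihilator S W
  have hI : IsLocalRing.maximalIdeal S ≤ I.radical := by
    rw [← hs, Ideal.span_le]
    intro x hx
    obtain ⟨t, ht⟩ := (inferInstance : Module.Finite S W).fg_top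
    choose n hn using hW x hx
    -- The largest exponent needed on a finite generating set of `W` works for all of `W`.
    refine ⟨t.sup n, Module.mem_annihilator.2 fun z ↦ ?_⟩
    have : (⊤ : Submodule S W) ≤ LinearMap.ker (LinearMap.lsmul S W (x ^ t.sup n)) := by
      rw [← ht, Submodule.span_le]
      intro y hy
      obtain ⟨k, hk⟩ := Nat.exists_eq_add_of_le (Finset.le_sup (f := n) hy)
      simp [hk, pow_add, mul_comm, mul_smul, hn y]
    exact this (x := z) trivial
  let := Module.quotientAnnihilator (R := S) (M := W)
  have : IsScalarTower S (S ⧸ I) W := ⟨fun a b w ↦ by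
    obtain ⟨b, rfl⟩ := Ideal.Quotient.mk_surjective b
    exact mul_smul a b w⟩
  have : IsScalarTower R (S ⧸ I) W := ⟨fun a b w ↦ by
    rw [← algebraMap_smul S a b, smul_assoc, algebraMap_smul]⟩
  have : Module.Finite (S ⧸ I) W := Module.Finite.of_restrictScalars_finite S _ _
  have : Module.Finite R (S ⧸ I) := by
    by_cases htop : I = ⊤
    · have : Subsingleton (S ⧸ I) := Ideal.Quotient.subsingleton_iff.2 htop
      infer_instance
    have hle : I ≤ IsLocalRing.maximalIdeal S := IsLocalRing.le_maximalIdeal htop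
    let f : (S ⧸ I) →ₐ[R] IsLocalRing.ResidueField S := Ideal.Quotient.factorₐ R hle
    -- The kernel of `S ⧸ I → ℓ` is finitely generated and consists of nilpotents, so finiteness
    -- over `R` lifts from `ℓ`.
    refine Module.finite_of_surjective_of_ker_le_nilradical f
      (Ideal.Quotient.factor_surjective hle) (fun x hx ↦ ?_) (IsNoetherian.noetherian _)
    obtain ⟨x, rfl⟩ := Ideal.Quotient.mk_surjective x
    obtain ⟨n, hn⟩ := hI (Ideal.Quotient.eq_zero_iff_mem.1 hx)
    exact ⟨n, by rw [← map_pow]; exact Ideal.Quotient.eq_zero_iff_mem.2 hn⟩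
  exact Module.Finite.trans (S ⧸ I) W

namespace ModuleCat

variable {R S : Type u} [CommRing R] [CommRing S] (φ : R →+* S)

lemma projective_extendScalars_obj (X : ModuleCat.{u} R) [Projective X] :
    Projective ((extendScalars.{u, u, u} φ).obj X) :=
  (extendRestrictScalarsAdj.{u, u, u} φ).map_projective X inferInstance

lemma finite_extendScalars_obj (X : ModuleCat.{u} R) [Module.Finite R X] :
    Module.Finite S ((extendScalars.{u, u, u} φ).obj X) := by
  let := φ.toAlgebra
  exact inferInstanceAs (Module.Finite S (TensorProduct R S X))

lemma flat_restrictScalars_obj {φ : R →+* S} (hφ : φ.Flat) (Y : ModuleCat.{u} S)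
    [Module.Flat S Y] : Module.Flat R ((restrictScalars.{u} φ).obj Y) := by
  let := φ.toAlgebra
  let : Module R Y := Module.compHom Y φ
  have : IsScalarTower R S Y := ⟨fun r s y ↦ mul_smul (φ r) s y⟩
  have : Module.Flat R S := hφ
  exact Module.Flat.trans R S Y

/-- A flat local homomorphism is faithfully flat. -/
lemma isZero_of_isZero_extendScalars_obj [IsLocalRing R] [IsLocalRing S] {φ : R →+* S}
    [IsLocalHom φ] (hφ : φ.Flat) (X : ModuleCat.{u} R)
    (h : IsZero ((extendScalars.{u, u, u} φ).obj X)) : IsZero X := by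
  let := φ.toAlgebra
  have : Module.Flat R S := hφ
  have : IsLocalHom (algebraMap R S) := ‹IsLocalHom φ›
  have : Module.FaithfullyFlat R S := Module.FaithfullyFlat.of_flat_of_isLocalHom
  have : Subsingleton (TensorProduct R S X) := subsingleton_of_isZero h
  have := Module.FaithfullyFlat.lTensor_reflects_triviality R S X
  exact isZero_of_subsingleton X

lemma isZero_of_isZero_restrictScalars_obj (Y : ModuleCat.{u} S)
    (h : IsZero ((restrictScalars.{u} φ).obj Y)) : IsZero Y := by
  have : Subsingleton Y := subsingleton_of_isZero (M := (restrictScalars.{u} φ).obj Y) h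
  exact isZero_of_subsingleton Y

/-- If `mS` is the maximal ideal of `S`, then the residue field of `S` is obtained by base change
from the residue field of `R`. -/
def extendScalarsResidueFieldIso [IsLocalRing R] [IsLocalRing S]
    (hmax : (IsLocalRing.maximalIdeal R).map φ = IsLocalRing.maximalIdeal S) :
    (extendScalars.{u, u, u} φ).obj (ModuleCat.of R (IsLocalRing.ResidueField R)) ≅
      ModuleCat.of S (IsLocalRing.ResidueField S) :=
  letI := φ.toAlgebra
  LinearEquiv.toModuleIso
    ((Algebra.TensorProduct.quotIdealMapEquivTensorQuot S
      (IsLocalRing.maximalIdeal R)).symm.toLinearEquiv ≪≫ₗ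
      Submodule.quotEquivOfEq _ _ hmax)

end ModuleCat

/-! ### Koszul complexes as iterated mapping cones -/

namespace CochainComplex

variable {R : Type u} [CommRing R]

/-- Multiplication by a scalar on a mapping cone of the same multiplication is homotopic to zero. -/
def homotopySMulMappingCone (x : R) (K : CochainComplex (ModuleCat.{u} R) ℤ) :
    Homotopy (x • 𝟙 (mappingCone (x • 𝟙 K))) 0 :=
  (HomComplex.Cochain.equivHomotopy _ _).symm
    -- The homotopy sends the target copy of `K` identically to the source copy; its differential is
    -- `x` times the decomposition of the identity of the cone.
    ⟨(mappingCone.snd (x • 𝟙 K)).comp (mappingCone.inl (x • 𝟙 K)) (zero_add (-1)), by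
      rw [HomComplex.δ_zero_cochain_comp _ _ _ (neg_add_cancel 1), mappingCone.δ_inl,
        mappingCone.δ_snd]
      ext p
      have h := mappingCone.id_X (x • 𝟙 K) p (p + 1) rfl
      simp [← h, HomComplex.Cochain.comp_v _ _ (add_neg_cancel 1) p (p + 1) p rfl (by lia)]
      exact add_comm _ _⟩

lemma homologyMap_smul (x : R) {K L : CochainComplex (ModuleCat.{u} R) ℤ} (f : K ⟶ L) (i : ℤ) :
    HomologicalComplex.homologyMap (x • f) i = x • HomologicalComplex.homologyMap f i :=
  ShortComplex.homologyMap_smul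
    ((HomologicalComplex.shortComplexFunctor (ModuleCat.{u} R) (.up ℤ) i).map f) x

lemma smul_homology_mappingCone (x : R) (K : CochainComplex (ModuleCat.{u} R) ℤ) (i : ℤ)
    (z : (mappingCone (x • 𝟙 K)).homology i) : x • z = 0 := by
  have h := (homotopySMulMappingCone x K).homologyMap_eq i
  rw [homologyMap_smul, HomologicalComplex.homologyMap_id, HomologicalComplex.homologyMap_zero] at h
  exact congr($(h).hom z)

lemma exact_homology_mappingCone {K L : CochainComplex (ModuleCat.{u} R) ℤ} (f : K ⟶ L) (i : ℤ) :
    ∃ (a : L.homology i →ₗ[R] (mappingCone f).homology i)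
      (b : (mappingCone f).homology i →ₗ[R] K.homology (i + 1)), Function.Exact a b := by
  have hS := shortExact_of_degreewise_splitting _ (mappingCone.triangleRotateShortComplexSplitting f)
  have h := hS.homology_exact₂ i
  rw [ShortComplex.ShortExact.moduleCat_exact_iff_function_exact] at h
  let e : (K⟦(1 : ℤ)⟧).homology i ≅ K.homology (i + 1) :=
    ((HomologicalComplex.homologyFunctor (ModuleCat.{u} R) (.up ℤ) 0).shiftIso 1 i (i + 1) (by lia)).app K
  refine ⟨(HomologicalComplex.homologyMap (mappingCone.inr f) i).hom, e.toLinearEquiv.toLinearMap ∘ₗ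
    (HomologicalComplex.homologyMap (mappingCone.triangle f).mor₃ i).hom, fun z ↦ ?_⟩
  exact (LinearEquiv.map_eq_zero_iff e.toLinearEquiv).trans (h z)

lemma finite_homology_mappingCone [IsNoetherianRing R]
    {K L : CochainComplex (ModuleCat.{u} R) ℤ} (f : K ⟶ L)
    (hK : ∀ i, Module.Finite R (K.homology i)) (hL : ∀ i, Module.Finite R (L.homology i)) (i : ℤ) :
    Module.Finite R ((mappingCone f).homology i) := by
  obtain ⟨a, b, h⟩ := exact_homology_mappingCone f i
  have := hK (i + 1)
  have := hL i
  have := isNoetherian_of_range_eq_ker a b h.linearMap_ker_eq.symm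
  infer_instance

/-- Annihilation by `x` itself need not pass to extensions, but power torsion does, the exponents
adding up. -/
lemma isTorsion_homology_mappingCone (x : R) {K L : CochainComplex (ModuleCat.{u} R) ℤ} (f : K ⟶ L)
    (hK : ∀ i (z : K.homology i), ∃ n : ℕ, x ^ n • z = 0)
    (hL : ∀ i (z : L.homology i), ∃ n : ℕ, x ^ n • z = 0) (i : ℤ) (z : (mappingCone f).homology i) :
    ∃ n : ℕ, x ^ n • z = 0 := by
  obtain ⟨a, b, h⟩ := exact_homology_mappingCone f i
  obtain ⟨n, hn⟩ := hK (i + 1) (b z)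
  rw [← map_smul] at hn
  obtain ⟨y, hy⟩ := (h _).1 hn
  obtain ⟨m, hm⟩ := hL i y
  exact ⟨m + n, by rw [pow_add, mul_smul, ← hy, ← map_smul, hm, map_zero]⟩

lemma HasBoundedHomology.mappingCone {C : Type*} [Category* C] [Abelian C]
    {K L : CochainComplex C ℤ} (f : K ⟶ L) (hK : K.HasBoundedHomology)
    (hL : L.HasBoundedHomology) : (CochainComplex.mappingCone f).HasBoundedHomology :=
  HasBoundedHomology.of_shortExact₂ (shortExact_of_degreewise_splitting _
    (mappingCone.triangleRotateShortComplexSplitting f)) hL (hK.shift 1)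

/-- If the mapping cone of the zero morphism has bounded homology, then so does the target. -/
lemma HasBoundedHomology.of_mappingCone_zero {C : Type*} [Category* C] [Abelian C]
    {K L : CochainComplex C ℤ} {f : K ⟶ L} (hf : f = 0)
    (h : (CochainComplex.mappingCone f).HasBoundedHomology) : L.HasBoundedHomology := by
  obtain ⟨n, hn⟩ := h
  refine ⟨n, fun i hi ↦ ?_⟩
  rw [HomologicalComplex.exactAt_iff_isZero_homology]
  -- Since `f = 0`, the identity of `L` extends by zero to the cone and retracts the inclusion of
  -- `L`.
  let r : CochainComplex.mappingCone f ⟶ L := mappingCone.desc f 0 (𝟙 L) (by simp [hf])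
  have : HomologicalComplex.homologyMap (mappingCone.inr f) i ≫
      HomologicalComplex.homologyMap r i = 𝟙 _ := by
    rw [← HomologicalComplex.homologyMap_comp, mappingCone.inr_desc,
      HomologicalComplex.homologyMap_id]
  rw [IsZero.iff_id_eq_zero, ← this, (hn i hi).isZero_homology.eq_of_tgt
    (HomologicalComplex.homologyMap (mappingCone.inr f) i) 0, zero_comp]

/-- Multiplication by `x` is zero on `Z ⊗ K`, so tensoring with `Z` turns the cone into the cone of
a zero map. -/
lemma HasBoundedHomology.of_tensorModule_mappingCone {x : R} {Z : ModuleCat.{u} R}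
    (hZ : ∀ z : Z, x • z = 0) {K : CochainComplex (ModuleCat.{u} R) ℤ}
    (h : (tensorModule Z (CochainComplex.mappingCone (x • 𝟙 K))).HasBoundedHomology) :
    (tensorModule Z K).HasBoundedHomology := by
  refine HasBoundedHomology.of_mappingCone_zero (K := tensorModule Z K)
    (f := ((tensorLeft Z).mapHomologicalComplex (.up ℤ)).map (x • 𝟙 K)) ?_
    (h.of_iso (mappingCone.mapHomologicalComplexIso (x • 𝟙 K) (tensorLeft Z)))
  ext i : 1
  apply ModuleCat.hom_ext
  refine TensorProduct.ext' fun z y ↦ ?_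
  change z ⊗ₜ[R] (x • y) = 0
  rw [← TensorProduct.smul_tmul, hZ, TensorProduct.zero_tmul]

/-- The iterated mapping cone of multiplication by the elements of a list. -/
def koszulCone (K : CochainComplex (ModuleCat.{u} R) ℤ) :
    List R → CochainComplex (ModuleCat.{u} R) ℤ
  | [] => K
  | x :: l => mappingCone (x • 𝟙 (koszulCone K l))

section

variable {K : CochainComplex (ModuleCat.{u} R) ℤ}

lemma isStrictlyLE_koszulCone (b : ℤ) [K.IsStrictlyLE b] :
    ∀ l : List R, (koszulCone K l).IsStrictlyLE b
  | [] => ‹_›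
  | x :: l => have := isStrictlyLE_koszulCone b l; isStrictlyLE_mappingCone _ b

lemma flat_koszulCone (hK : ∀ i, Module.Flat R (K.X i)) :
    ∀ (l : List R) (i : ℤ), Module.Flat R ((koszulCone K l).X i)
  | [] => hK
  | _ :: l => flat_mappingCone _ (flat_koszulCone hK l) (flat_koszulCone hK l)

lemma HasBoundedHomology.koszulCone (hK : K.HasBoundedHomology) :
    ∀ l : List R, (koszulCone K l).HasBoundedHomology
  | [] => hK
  | _ :: l => HasBoundedHomology.mappingCone _ (hK.koszulCone l) (hK.koszulCone l)

lemma HasBoundedHomology.mapBifunctor_koszulCone {C : Type*} [Category* C] [Preadditive C]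
    {T : Type u} [Ring T] {F : C ⥤ ModuleCat.{u} R ⥤ ModuleCat.{u} T} [F.Additive]
    [∀ X, (F.obj X).Additive] {P : CochainComplex C ℤ}
    (hK : (mapBifunctor P K F).HasBoundedHomology) :
    ∀ l : List R, (mapBifunctor P (CochainComplex.koszulCone K l) F).HasBoundedHomology
  | [] => hK
  | _ :: l => HasBoundedHomology.mapBifunctor_mappingCone _
      (hK.mapBifunctor_koszulCone l) (hK.mapBifunctor_koszulCone l)

lemma finite_homology_koszulCone [IsNoetherianRing R] (hK : ∀ i, Module.Finite R (K.homology i)) :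
    ∀ (l : List R) (i : ℤ), Module.Finite R ((koszulCone K l).homology i)
  | [] => hK
  | _ :: l => finite_homology_mappingCone _ (finite_homology_koszulCone hK l)
      (finite_homology_koszulCone hK l)

/-- The cone on `x` makes `x` kill homology, and further cones preserve `x`-power torsion. -/
lemma isTorsion_homology_koszulCone (x : R) : ∀ (l : List R) (_ : x ∈ l) (i : ℤ)
    (z : (koszulCone K l).homology i), ∃ n : ℕ, x ^ n • z = 0
  | y :: l, h, i, z => by
    by_cases hx : x ∈ l
    · exact isTorsion_homology_mappingCone x _ (isTorsion_homology_koszulCone x l hx)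
        (isTorsion_homology_koszulCone x l hx) i z
    · obtain rfl : x = y := by simpa [hx] using h
      exact ⟨1, by rw [pow_one]; exact smul_homology_mappingCone x _ i z⟩

lemma HasBoundedHomology.of_tensorModule_koszulCone {Z : ModuleCat.{u} R} :
    ∀ (l : List R) (_ : ∀ x ∈ l, ∀ z : Z, x • z = 0)
      (_ : (tensorModule Z (CochainComplex.koszulCone K l)).HasBoundedHomology),
    (tensorModule Z K).HasBoundedHomology
  | [], _, h => h
  | x :: l, hl, h => of_tensorModule_koszulCone l (fun y hy ↦ hl y (by simp [hy]))
      (h.of_tensorModule_mappingCone (hl x (by simp)))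

end

end CochainComplex

/-! ### Change of rings for complexes and homological finiteness -/

section

variable {R S : Type u} [CommRing R] [CommRing S] (φ : R →+* S)

namespace CochainComplex

lemma isStrictlyLE_extendScalars (P : CochainComplex (ModuleCat.{u} R) ℤ) (n : ℤ)
    [P.IsStrictlyLE n] : (extendScalars φ P).IsStrictlyLE n := by
  rw [isStrictlyLE_iff]
  exact fun i hi ↦ (ModuleCat.extendScalars.{u, u, u} φ).map_isZero
    (P.isZero_of_isStrictlyLE n i hi)

lemma isStrictlyLE_restrictScalars (Y : CochainComplex (ModuleCat.{u} S) ℤ) (n : ℤ)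
    [Y.IsStrictlyLE n] : (restrictScalars φ Y).IsStrictlyLE n := by
  rw [isStrictlyLE_iff]
  exact fun i hi ↦ (ModuleCat.restrictScalars.{u} φ).map_isZero (Y.isZero_of_isStrictlyLE n i hi)

/-- Extension of scalars commutes with the tensor product of a module and a complex. -/
def tensorModuleExtendScalarsIso (Z : ModuleCat.{u} R) (Y : CochainComplex (ModuleCat.{u} R) ℤ) :
    tensorModule ((ModuleCat.extendScalars.{u, u, u} φ).obj Z) (extendScalars φ Y) ≅
      extendScalars φ (tensorModule Z Y) :=
  HomologicalComplex.Hom.isoOfComponents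
    (fun i ↦ Functor.Monoidal.μIso (ModuleCat.extendScalars.{u, u, u} φ) Z (Y.X i))
    (fun i j _ ↦ (Functor.LaxMonoidal.μ_natural_right
      (ModuleCat.extendScalars.{u, u, u} φ) Z (Y.d i j)).symm)

/-- The projection formula for the tensor product of a module and a complex. -/
def tensorModuleRestrictScalarsIso (Z : ModuleCat.{u} R) (Y : CochainComplex (ModuleCat.{u} S) ℤ) :
    tensorModule Z (restrictScalars φ Y) ≅
      restrictScalars φ (tensorModule ((ModuleCat.extendScalars.{u, u, u} φ).obj Z) Y) :=
  HomologicalComplex.Hom.isoOfComponents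
    (fun i ↦ ModuleCat.projectionFormulaIso φ Z (Y.X i))
    (fun i j _ ↦ (ModuleCat.projectionFormulaIso_naturality_right φ Z (Y.d i j)).symm)

/-- Isomorphic modules have isomorphic tensor products with a complex. -/
def tensorModuleMapIso {Z Z' : ModuleCat.{u} R} (e : Z ≅ Z')
    (Y : CochainComplex (ModuleCat.{u} R) ℤ) : tensorModule Z Y ≅ tensorModule Z' Y :=
  (NatIso.mapHomologicalComplex ((curriedTensor (ModuleCat.{u} R)).mapIso e) (.up ℤ)).app Y

end CochainComplex

namespace DerivedCategory

variable [HasDerivedCategory.{w} (ModuleCat.{u} R)] [HasDerivedCategory.{w'} (ModuleCat.{u} S)]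

lemma isHomologicallyFinite_Q_obj_extendScalars {φ : R →+* S} (hφ : φ.Flat)
    (K : CochainComplex (ModuleCat.{u} R) ℤ) (hK : (Q.obj K).IsHomologicallyFinite) :
    (Q.obj (CochainComplex.extendScalars φ K)).IsHomologicallyFinite := by
  have := ModuleCat.preservesFiniteLimits_extendScalars_of_flat hφ
  rw [isHomologicallyFinite_Q_obj_iff] at hK ⊢
  refine ⟨hK.1.map _, fun i ↦ ?_⟩
  have := hK.2 i
  have := ModuleCat.finite_extendScalars_obj φ (K.homology i)
  exact Module.Finite.equiv (CochainComplex.homologyMapIso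
    (ModuleCat.extendScalars.{u, u, u} φ) K i).toLinearEquiv.symm

lemma IsHomologicallyFinite.derivedBaseChange {φ : R →+* S} (hφ : φ.Flat)
    {M : DerivedCategory (ModuleCat.{u} R)} (hM : M.IsHomologicallyFinite) :
    (DerivedCategory.derivedBaseChange φ hM.isRightBounded).IsHomologicallyFinite :=
  isHomologicallyFinite_Q_obj_extendScalars hφ _ (hM.of_iso hM.isRightBounded.projRes.iso.symm)

-- Restriction to `R` keeps homology finitely generated here only thanks to the torsion condition,
-- which is what Koszul cones provide.
omit [HasDerivedCategory.{w'} (ModuleCat.{u} S)] in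
lemma isHomologicallyFinite_Q_obj_restrictScalars [IsLocalRing S] [IsNoetherianRing S]
    (hfin : ((IsLocalRing.residue S).comp φ).Finite) (s : Set S)
    (hs : Ideal.span s = IsLocalRing.maximalIdeal S) (K : CochainComplex (ModuleCat.{u} S) ℤ)
    (hK : K.HasBoundedHomology) (hK' : ∀ i, Module.Finite S (K.homology i))
    (h : ∀ x ∈ s, ∀ i, ∀ z : K.homology i, ∃ n : ℕ, x ^ n • z = 0) :
    (Q.obj (CochainComplex.restrictScalars φ K)).IsHomologicallyFinite := by
  rw [isHomologicallyFinite_Q_obj_iff]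
  refine ⟨hK.map _, fun i ↦ ?_⟩
  let := φ.toAlgebra
  let : Module R (K.homology i) := Module.compHom _ φ
  have : IsScalarTower R S (K.homology i) := ⟨fun r s y ↦ mul_smul (φ r) s y⟩
  have : Module.Finite R (IsLocalRing.ResidueField S) := hfin
  have := hK' i
  have : Module.Finite R (K.homology i) :=
    Module.finite_of_isTorsion_of_finite_residueField R s hs fun x hx ↦ h x hx i
  have : Module.Finite R ((ModuleCat.restrictScalars.{u} φ).obj (K.homology i)) := this
  exact Module.Finite.equiv (CochainComplex.homologyMapIso
    (ModuleCat.restrictScalars.{u} φ) K i).toLinearEquiv.symm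

end DerivedCategory

end

/-! ### The two implications -/

open DerivedCategory CochainComplex

section

variable {R S : Type u} [CommRing R] [IsLocalRing R] [IsNoetherianRing R]
    [CommRing S] [IsLocalRing S] [IsNoetherianRing S]
    [HasDerivedCategory.{w} (ModuleCat.{u} R)] [HasDerivedCategory.{w'} (ModuleCat.{u} S)]
    {φ : R →+* S} [IsLocalHom φ] (hflat : φ.Flat)
    {M : DerivedCategory (ModuleCat.{u} R)} (hM : M.IsHomologicallyFinite)

-- Descent: the hypothesis on `S ⊗ M` is applied to `S ⊗ N`, and boundedness of `k ⊗ᴸ N` is detected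
-- after faithfully flat base change.
omit [IsNoetherianRing S] in
include hflat in
lemma DerivedCategory.isPdTestComplex_of_derivedBaseChange
    (h : (derivedBaseChange φ hM.isRightBounded).IsPdTestComplex) : M.IsPdTestComplex := by
  refine ⟨hM, fun N hN hMN ↦ ?_⟩
  obtain ⟨hMS, h⟩ := h
  have := ModuleCat.preservesFiniteLimits_extendScalars_of_flat hflat
  let P := hM.isRightBounded.projRes
  obtain ⟨a, ha⟩ : ∃ a, P.P.IsStrictlyLE a := P.bounded
  have hP := P.projective
  let L := hN.isRightBounded.projRes
  obtain ⟨b, hb⟩ : ∃ b, L.P.IsStrictlyLE b := L.bounded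
  have hL := L.projective
  have := isStrictlyLE_extendScalars φ P.P a
  have := isStrictlyLE_extendScalars φ L.P b
  have hNS := isHomologicallyFinite_Q_obj_extendScalars hflat L.P (hN.of_iso L.iso.symm)
  have hpd := h _ hNS ((isHomologicallyBounded_derivedTensor_iff _ _ (extendScalars φ P.P) a
    (fun i ↦ ModuleCat.projective_extendScalars_obj φ (P.P.X i)) (Iso.refl _)
    (extendScalars φ L.P) (Iso.refl _)).2
      ((((isHomologicallyBounded_derivedTensor_iff _ _ P.P a hP P.iso L.P L.iso).1 hMN).map
        (ModuleCat.extendScalars.{u, u, u} φ)).of_iso (extendScalarsTensorIso φ P.P L.P).symm))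
  refine hasFiniteProjDim_of_hasBoundedHomology hN L.P b
    (fun i ↦ flat_of_projective (L.P.X i)) L.iso
    (HasBoundedHomology.of_map (ModuleCat.extendScalars.{u, u, u} φ)
      (ModuleCat.isZero_of_isZero_extendScalars_obj hflat) ?_)
  refine HasBoundedHomology.of_iso (tensorModuleExtendScalarsIso φ _ L.P)
    (hpd.hasBoundedHomology_tensorModule (extendScalars φ L.P) b (fun i ↦ ?_) (Iso.refl _) _)
  exact @flat_of_projective _ _ _ (ModuleCat.projective_extendScalars_obj φ (L.P.X i))

-- Ascent: the test property of `M` is applied to a Koszul complex of `N` viewed over `R`.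
include hflat in
lemma DerivedCategory.IsPdTestComplex.derivedBaseChange
    (hmax : (IsLocalRing.maximalIdeal R).map φ = IsLocalRing.maximalIdeal S)
    (hfin : (IsLocalRing.ResidueField.map φ).Finite)
    (h : M.IsPdTestComplex) :
    (DerivedCategory.derivedBaseChange φ hM.isRightBounded).IsPdTestComplex := by
  refine ⟨hM.derivedBaseChange hflat, fun N hN hMN ↦ ?_⟩
  obtain ⟨_, h⟩ := h
  let P := hM.isRightBounded.projRes
  obtain ⟨a, ha⟩ : ∃ a, P.P.IsStrictlyLE a := P.bounded
  have hP := P.projective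
  let L := hN.isRightBounded.projRes
  obtain ⟨b, hb⟩ : ∃ b, L.P.IsStrictlyLE b := L.bounded
  have hL := L.projective
  have hL' (i : ℤ) : Module.Flat S (L.P.X i) := flat_of_projective _
  have := isStrictlyLE_extendScalars φ P.P a
  obtain ⟨s, hs⟩ := IsNoetherian.noetherian (IsLocalRing.maximalIdeal R)
  -- Because `𝔪S = 𝔫`, the images of generators of `𝔪` generate `𝔫`.
  let l : List S := s.toList.map φ
  have hl : Ideal.span {x | x ∈ l} = IsLocalRing.maximalIdeal S := by
    rw [← hmax, ← hs, ← Ideal.span, Ideal.map_span]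
    congr 1
    ext x
    simp [l]
  let K := koszulCone L.P l
  have hKb : K.IsStrictlyLE b := isStrictlyLE_koszulCone b l
  have hKR : (restrictScalars φ K).IsStrictlyLE b := isStrictlyLE_restrictScalars φ K b
  have hKflat (i : ℤ) : Module.Flat R ((restrictScalars φ K).X i) := by
    have : Module.Flat S (K.X i) := flat_koszulCone hL' l i
    exact ModuleCat.flat_restrictScalars_obj hflat (K.X i)
  have htensor := (isHomologicallyBounded_derivedTensor_iff _ _ (extendScalars φ P.P) a
    (fun i ↦ ModuleCat.projective_extendScalars_obj φ (P.P.X i)) (Iso.refl _) L.P L.iso).1 hMN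
  have htensorK : HasBoundedHomology (HomologicalComplex.tensorObj (extendScalars φ P.P) K) :=
    HasBoundedHomology.mapBifunctor_koszulCone (F := curriedTensor (ModuleCat.{u} S)) htensor l
  obtain ⟨hLb, hLfin⟩ := (isHomologicallyFinite_Q_obj_iff L.P).1 (hN.of_iso L.iso.symm)
  -- The map `R → ℓ` factors as the surjection `R → k` followed by the finite map `k → ℓ`.
  have hres : ((IsLocalRing.residue S).comp φ).Finite :=
    hfin.comp (RingHom.Finite.of_surjective _ IsLocalRing.residue_surjective)
  have hV : (Q.obj (restrictScalars φ K)).IsHomologicallyFinite :=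
    isHomologicallyFinite_Q_obj_restrictScalars φ hres _ hl K (hLb.koszulCone l)
      (finite_homology_koszulCone hLfin l) fun x hx ↦ isTorsion_homology_koszulCone x l hx
  have hpd := h _ hV ((isHomologicallyBounded_derivedTensor_iff _ _ P.P a hP P.iso
    (restrictScalars φ K) (Iso.refl _)).2
      ((htensorK.map (ModuleCat.restrictScalars.{u} φ)).of_iso
        (tensorRestrictScalarsIso φ P.P K).symm))
  have hk := hpd.hasBoundedHomology_tensorModule (restrictScalars φ K) b hKflat (Iso.refl _)
    (ModuleCat.of R (IsLocalRing.ResidueField R))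
  have hkS := HasBoundedHomology.of_map (ModuleCat.restrictScalars.{u} φ)
    (ModuleCat.isZero_of_isZero_restrictScalars_obj φ)
    (hk.of_iso (tensorModuleRestrictScalarsIso φ _ K))
  -- Over `S` the relevant module is `S ⊗ k`, which is `ℓ` by `hmax`.
  have hkS' := hkS.of_iso (tensorModuleMapIso (ModuleCat.extendScalarsResidueFieldIso φ hmax) K)
  refine hasFiniteProjDim_of_hasBoundedHomology hN L.P b hL' L.iso
    (HasBoundedHomology.of_tensorModule_koszulCone l (fun x hx z ↦ ?_) hkS')
  -- The Koszul elements lie in `𝔫` and so annihilate `ℓ`, which permits removing the cones.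
  have hx' : x ∈ IsLocalRing.maximalIdeal S := hl ▸ Ideal.subset_span hx
  obtain ⟨z, rfl⟩ := IsLocalRing.residue_surjective z
  change IsLocalRing.residue S (x * z) = 0
  rw [IsLocalRing.residue_eq_zero_iff]
  exact Ideal.mul_mem_right _ _ hx'

end

end

theorem mainTheorem8 {R S : Type u} [CommRing R] [IsLocalRing R] [IsNoetherianRing R]
    [CommRing S] [IsLocalRing S] [IsNoetherianRing S]
    [HasDerivedCategory.{w} (ModuleCat.{u} R)] [HasDerivedCategory.{w'} (ModuleCat.{u} S)]
    (φ : R →+* S) [IsLocalHom φ] (hflat : φ.Flat)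
    (hmax : (IsLocalRing.maximalIdeal R).map φ = IsLocalRing.maximalIdeal S)
    (hfin : (IsLocalRing.ResidueField.map φ).Finite)
    (M : DerivedCategory (ModuleCat.{u} R)) (hM : M.IsHomologicallyFinite) :
    M.IsPdTestComplex ↔
      (DerivedCategory.derivedBaseChange φ hM.isRightBounded).IsPdTestComplex :=
  ⟨fun h ↦ h.derivedBaseChange hflat hM hmax hfin,
    fun h ↦ DerivedCategory.isPdTestComplex_of_derivedBaseChange hflat hM h⟩
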